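/- Let $\Omega\subset\mathbb R^n$ be a bounded domain and let $f=f(x,z,p)$ be a positive function of class $C^2$ on $\overline\Omega\times\mathbb R\times\mathbb R^n$. For all real numbers $A,B$ there are constants $\beta>0$ and $C>0$, depending only on $\Omega$, $f$, $A$ and $B$, such that the following holds. Let $u\in C^4(\Omega)\cap C^0(\overline\Omega)$ be a $2$-convex solution of the Dirichlet problem $$\sigma_2(D^2u)=f(x,u,\nabla u)\ \text{ in }\Omega,\qquad u=0\ \text{ on }\partial\Omega,$$ with $\sup_\Omega|u|\le A$ and $\sup_\Omega|\nabla u|\le B$. Then $$(-u)^{\beta}\,\Delta u\le C\quad\text{in }\Omega .$$ Here $\sigma_m(D^2u)$ is the $m$-th elementary symmetric function of the eigenvalues of the Hessian $D^2u$, and $u$ is called $2$-convex if $\sigma_1(D^2u)>0$ and $\sigma_2(D^2u)>0$ at every point of $\Omega$. (Such a function $u$ is negative in $\Omega$ by the maximum principle, so that $(-u)^\beta$ makes sense.) -/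

import Mathlib

open scoped InnerProductSpace Gradient

noncomputable section

namespace HessianEq

/-- The `k`-th elementary symmetric function `σ_k(κ)` of `κ ∈ ℝⁿ`. -/
def sigma {n : ℕ} (k : ℕ) (κ : Fin n → ℝ) : ℝ :=
  ∑ s ∈ Finset.powersetCard k (Finset.univ : Finset (Fin n)), ∏ i ∈ s, κ i

/-- The Gårding cone `Γ_k = {κ ∈ ℝⁿ | σ_m(κ) > 0 for m = 1, …, k}`. -/
def gardingCone (n k : ℕ) : Set (Fin n → ℝ) :=
  {κ | ∀ m : ℕ, 1 ≤ m → m ≤ k → 0 < sigma m κ}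

/-- The Hessian matrix `D²u(x) = (∂ᵢ∂ⱼu(x))`. -/
def hessian {n : ℕ} (u : EuclideanSpace ℝ (Fin n) → ℝ) (x : EuclideanSpace ℝ (Fin n)) :
    Matrix (Fin n) (Fin n) ℝ :=
  Matrix.of fun i j =>
    fderiv ℝ (fderiv ℝ u) x (EuclideanSpace.single i 1) (EuclideanSpace.single j 1)

/-- The Hessian matrix of a function that is `C²` near `x` is symmetric. -/
theorem hessian_isHermitian {n : ℕ} {u : EuclideanSpace ℝ (Fin n) → ℝ}
    {x : EuclideanSpace ℝ (Fin n)} (hu : ContDiffAt ℝ 2 u x) : (hessian u x).IsHermitian := by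
  have h : IsSymmSndFDerivAt ℝ u x := hu.isSymmSndFDerivAt (by simp)
  ext i j
  simpa [hessian] using h (EuclideanSpace.single j 1) (EuclideanSpace.single i 1)

open Classical in
/-- The eigenvalues, with multiplicity, of the Hessian matrix of `u` at `x`. The matrix is
symmetric wherever `u` is `C²` (`hessian_isHermitian`); the value `0` in the other case plays no
role. -/
def hessianEigenvalues {n : ℕ} (u : EuclideanSpace ℝ (Fin n) → ℝ)
    (x : EuclideanSpace ℝ (Fin n)) : Fin n → ℝ :=
  if h : (hessian u x).IsHermitian then h.eigenvalues else 0

/-- `u ∈ C²(Ω)` is `k`-convex in the open set `Ω`: the eigenvalues of its Hessian lie in `Γ_k` at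
every point of `Ω`. -/
def IsKConvexOn {n : ℕ} (k : ℕ) (Ω : Set (EuclideanSpace ℝ (Fin n)))
    (u : EuclideanSpace ℝ (Fin n) → ℝ) : Prop :=
  ContDiffOn ℝ 2 u Ω ∧ ∀ x ∈ Ω, hessianEigenvalues u x ∈ gardingCone n k

/-- `u` is a classical admissible (that is, `k`-convex) solution of the Dirichlet problem
`σ_k(D²u) = f(x, u, ∇u)` in `Ω`, `u = 0` on `∂Ω`, with `u ∈ C⁴(Ω) ∩ C⁰(Ω̄)`. -/
structure IsSolution {n : ℕ} (k : ℕ) (Ω : Set (EuclideanSpace ℝ (Fin n)))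
    (f : EuclideanSpace ℝ (Fin n) × ℝ × EuclideanSpace ℝ (Fin n) → ℝ)
    (u : EuclideanSpace ℝ (Fin n) → ℝ) : Prop where
  contDiffOn : ContDiffOn ℝ 4 u Ω
  continuousOn : ContinuousOn u (closure Ω)
  kConvex : IsKConvexOn k Ω u
  equation : ∀ x ∈ Ω, sigma k (hessianEigenvalues u x) = f (x, u x, ∇ u x)
  boundary : ∀ x ∈ frontier Ω, u x = 0

end HessianEq

end

/-! The proof is a maximum principle argument for φ = log Δu + β log(-u - ε) + (a/2)|∇u|² +
(α/2)|x|² on the compact set {u ≤ -ε}, with ε → 0 at the end. At a maximum write s = Δu, w = -u - ε,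
let l be the Hessian eigenvalues, and let F_k = s - l_k ≥ 0 be the coefficients of the linearization
of σ₂ in an eigenframe. A bound for w^β s follows once s and s w cannot both exceed a constant K
(`false_of_critical`).

Put r_k = ∂_kΔu / s. The second order conditions, weighted by F_k and combined with the twice
differentiated equation, give |D³u|²/s - s Σ r_k² - Σ F_k r_k² - β Σ F_k (u_k/w)² + a Σ F_k l_k² + c
s ≤ 0, where c is what remains of α after absorbing the terms coming from f, log w and |∇u|². The
first order condition is r_k = β u_k/w - a l_k u_k - α x_k, and s, s w ≥ K make its first and last
terms at most a s.

If every l_i ≤ (1 - 1/800) s, the good term a Σ F_k l_k² is at least of order a s³, while the bad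
terms are O(a² s³); small a gives a contradiction (`false_of_forall_le`).

If some l_m > (1 - 1/800) s, the other eigenvalues are at most s/20 in size and the third
derivatives must be used (`third_order_le`): up to O(s²), |D³u|² dominates s² Σ r_k² + 1.1 s²
Σ_{k≠m} r_k². For k = m this is the concavity of σ₂ in Lorentzian form; for k ≠ m the differentiated
equation forces ∂_kΔu ≈ u_mmk, and u_mmk occurs three times in D³u. The surplus 1.1 absorbs F_k r_k²
≤ 1.05 s r_k² for k ≠ m, and the gradient term absorbs the direction m (`false_of_lt`). -/

/-! ### Third order terms when one eigenvalue dominates -/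

open Finset in
/-- Reverse Cauchy–Schwarz inequality for the Lorentzian form `(∑ X)² - ∑ X²`. -/
theorem sq_sum_sub_sum_sq_le {ι : Type*} [Fintype ι] {l X : ι → ℝ} {s d : ℝ}
    (hs0 : 0 < s) (hd : s ^ 2 - ∑ i, l i ^ 2 = d) (hd0 : 0 < d) :
    (∑ i, X i) ^ 2 - ∑ i, X i ^ 2 ≤ (∑ i, (s - l i) * X i) ^ 2 / d := by
  rw [le_div_iff₀ hd0]
  -- Subtracting `t` times the timelike vector with space part `l` and time part `s` kills the time
  -- component of `X`. The difference of the two sides is then `d * y` plus a square.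
  set t := (∑ i, X i) / s with ht
  have hX : ∑ i, X i = t * s := by rw [ht]; field_simp
  set y := ∑ i, (X i - t * l i) ^ 2 with hy
  have hy0 : 0 ≤ y := sum_nonneg fun i _ => sq_nonneg _
  set z := ∑ i, l i * X i with hz
  have h1 : y = ∑ i, X i ^ 2 - 2 * t * z + t ^ 2 * ∑ i, l i ^ 2 := by
    rw [hy, hz, mul_sum, mul_sum, ← sum_sub_distrib, ← sum_add_distrib]
    exact sum_congr rfl fun i _ => by ring
  have h2 : ∑ i, (s - l i) * X i = s * (t * s) - z := by
    rw [← hX, mul_sum, hz, ← sum_sub_distrib]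
    exact sum_congr rfl fun i _ => by ring
  rw [h2, hX]
  have h3 : ∑ i, X i ^ 2 = y + 2 * t * z - t ^ 2 * ∑ i, l i ^ 2 := by linarith
  have h4 : ∑ i, l i ^ 2 = s ^ 2 - d := by linarith
  rw [h3, h4]
  nlinarith [mul_nonneg hy0 hd0.le, sq_nonneg (s * (t * s) - z - t * d)]

/-- The off-diagonal entries `T m i m` occur at least twice in the block `T · · m`. -/
theorem sum_diag_add_two_mul_le {ι : Type*} [Fintype ι] [DecidableEq ι] {S : ι → ι → ℝ}
    (hS : ∀ i j, S i j = S j i) (m : ι) :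
    ∑ i, S i i ^ 2 + 2 * ∑ i ∈ Finset.univ.erase m, S m i ^ 2 ≤ ∑ i, ∑ j, S i j ^ 2 := by
  have h1 : ∑ i, ∑ j, S i j ^ 2 =
      ∑ j, S m j ^ 2 + ∑ i ∈ Finset.univ.erase m, ∑ j, S i j ^ 2 :=
    (Finset.add_sum_erase _ _ (Finset.mem_univ m)).symm
  have h2 : ∑ j, S m j ^ 2 = S m m ^ 2 + ∑ i ∈ Finset.univ.erase m, S m i ^ 2 :=
    (Finset.add_sum_erase _ _ (Finset.mem_univ m)).symm
  have h3 : ∑ i, S i i ^ 2 = S m m ^ 2 + ∑ i ∈ Finset.univ.erase m, S i i ^ 2 :=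
    (Finset.add_sum_erase _ _ (Finset.mem_univ m)).symm
  have h4 : ∑ i ∈ Finset.univ.erase m, (S i i ^ 2 + S m i ^ 2) ≤
      ∑ i ∈ Finset.univ.erase m, ∑ j, S i j ^ 2 := by
    refine Finset.sum_le_sum fun i hi => ?_
    rw [hS m i, ← Finset.sum_pair (f := fun j => S i j ^ 2) (Finset.ne_of_mem_erase hi)]
    exact Finset.sum_le_sum_of_subset_of_nonneg (Finset.subset_univ _)
      fun _ _ _ => sq_nonneg _
  rw [Finset.sum_add_distrib] at h4
  linarith

/-- If `σ` is close to `v` up to a bounded error and a small multiple of `τ ≥ |v|`, then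
`2 v² + τ²` dominates `2.1 σ²`. -/
theorem two_point_one_mul_sq_le {v τ σ c : ℝ} (hv : v ^ 2 ≤ τ ^ 2)
    (h : |σ - v| ≤ c + τ / 10) :
    21 / 10 * σ ^ 2 ≤ 2 * v ^ 2 + τ ^ 2 + 1000 * c ^ 2 := by
  set r := σ - v with hr
  have hσ : σ = v + r := by rw [hr]; ring
  have h1 : r ^ 2 ≤ (c + τ / 10) ^ 2 := by
    rw [← sq_abs r]; gcongr
  rw [hσ]
  have h2 : 21 / 10 * (v + r) ^ 2 ≤ 21 / 10 * (11 / 10 * v ^ 2 + 11 * r ^ 2) := by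
    nlinarith [sq_nonneg (v - 10 * r)]
  nlinarith [sq_nonneg (τ - 100 * c), sq_nonneg (v - 5 * r), sq_nonneg (v - 10 * r)]

/-- The differentiated equation reads s (tr S - S_mm) = g - (s - l_m) S_mm + Σ_{i≠m} l_i S_ii, and
each coefficient on the right is small compared with s. Hence, in a direction k, ∂_kΔu is nearly
u_mmk. -/
theorem abs_trace_sub_le {ι : Type*} [Fintype ι] [DecidableEq ι] {l : ι → ℝ} {S : ι → ι → ℝ}
    {s M g τ : ℝ} {m : ι} (hs0 : 0 < s) (hd : ∑ i, l i ^ 2 ≤ s ^ 2) (hms : l m ≤ s)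
    (hm : (1 - 1 / 800) * s < l m) (hg : |g| ≤ M * s) (hE : ∑ i, (s - l i) * S i i = g)
    (hτ : 0 ≤ τ) (hτS : ∑ i, ∑ j, S i j ^ 2 = τ ^ 2) :
    |∑ i, S i i - S m m| ≤ M + τ / 10 := by
  have hdiag : ∑ i, S i i ^ 2 ≤ τ ^ 2 := by
    rw [← hτS]
    exact Finset.sum_le_sum fun i _ =>
      Finset.single_le_sum (f := fun j => S i j ^ 2) (fun j _ => sq_nonneg _) (Finset.mem_univ i)
  have hmm : S m m ^ 2 ≤ τ ^ 2 :=
    (Finset.single_le_sum (f := fun i => S i i ^ 2) (fun j _ => sq_nonneg _)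
      (Finset.mem_univ m)).trans hdiag
  have hmm' : |S m m| ≤ τ := abs_le_of_sq_le_sq hmm hτ
  set z := ∑ i ∈ Finset.univ.erase m, l i * S i i with hz
  have h1 : s * (∑ i, S i i - S m m) = g - (s - l m) * S m m + z := by
    rw [← hE, hz, ← Finset.add_sum_erase _ _ (Finset.mem_univ m),
      ← Finset.add_sum_erase (a := m) _ (fun i => (s - l i) * S i i) (Finset.mem_univ m),
      add_sub_cancel_left, add_sub_cancel_left, ← Finset.sum_add_distrib, Finset.mul_sum]
    exact Finset.sum_congr rfl fun i _ => by ring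
  -- Here the threshold 1/800 is used: 1 - (1 - 1/800)² < 1/400 = (1/20)².
  have h2 : ∑ i ∈ Finset.univ.erase m, l i ^ 2 ≤ (s / 20) ^ 2 := by
    have := Finset.add_sum_erase (a := m) _ (fun i => l i ^ 2) (Finset.mem_univ m)
    nlinarith
  have h3 : ∑ i ∈ Finset.univ.erase m, S i i ^ 2 ≤ τ ^ 2 :=
    (Finset.sum_le_sum_of_subset_of_nonneg (Finset.subset_univ _)
      fun _ _ _ => sq_nonneg _).trans hdiag
  have h4 : |z| ≤ s / 20 * τ := by
    refine abs_le_of_sq_le_sq ?_ (by positivity)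
    calc z ^ 2 ≤ (∑ i ∈ Finset.univ.erase m, l i ^ 2) * ∑ i ∈ Finset.univ.erase m, S i i ^ 2 :=
          Finset.sum_mul_sq_le_sq_mul_sq _ _ _
      _ ≤ (s / 20) ^ 2 * τ ^ 2 := by
          gcongr
      _ = _ := by ring
  have h5 : |(s - l m) * S m m| ≤ s / 800 * τ := by
    rw [abs_mul, abs_of_nonneg (by linarith)]
    gcongr
    linarith
  have h6 : s * |∑ i, S i i - S m m| ≤ s * (M + τ / 10) := by
    rw [← abs_of_pos hs0, ← abs_mul, h1, abs_of_pos hs0]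
    have := abs_add_le (g - (s - l m) * S m m) z
    have := abs_sub g ((s - l m) * S m m)
    nlinarith [mul_nonneg hs0.le hτ]
  exact le_of_mul_le_mul_left h6 hs0

/-- Third order terms for the operator `σ₂` when one eigenvalue dominates. -/
theorem third_order_le {ι : Type*} [Fintype ι] [DecidableEq ι] {l g : ι → ℝ}
    {T : ι → ι → ι → ℝ} {s d d₀ M : ℝ} {m : ι}
    (hT₁ : ∀ i j k, T i j k = T j i k) (hT₂ : ∀ i j k, T i j k = T i k j)
    (hs1 : 1 ≤ s) (hd : s ^ 2 - ∑ i, l i ^ 2 = d) (hd₀ : 0 < d₀) (hdd : d₀ ≤ d)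
    (hms : l m ≤ s) (hm : (1 - 1 / 800) * s < l m) (hg : ∀ k, |g k| ≤ M * s)
    (hE : ∀ k, ∑ i, (s - l i) * T i i k = g k) :
    ∑ k, (∑ i, T i i k) ^ 2 + 11 / 10 * ∑ k ∈ Finset.univ.erase m, (∑ i, T i i k) ^ 2 ≤
      ∑ k, ∑ i, ∑ j, T i j k ^ 2 +
        (M ^ 2 / d₀ + 1000 * M ^ 2 * Fintype.card ι) * s ^ 2 := by
  have hs0 : 0 < s := by linarith
  have hgm : g m ^ 2 / d ≤ M ^ 2 / d₀ * s ^ 2 := by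
    rw [div_mul_eq_mul_div, ← mul_pow]
    have : g m ^ 2 ≤ (M * s) ^ 2 := by
      rw [← sq_abs]
      have := hg m
      gcongr
    gcongr
  -- Block k = m: the squared trace is paid for by the diagonal entries alone, at the cost of `g m ^
  -- 2 / d`. This leaves the off-diagonal entries of the block for k ≠ m.
  have h1 := sq_sum_sub_sum_sq_le (X := fun i => T i i m) hs0 hd (hd₀.trans_le hdd)
  simp only [hE m] at h1
  have h2 := sum_diag_add_two_mul_le (S := fun i j => T i j m) (fun i j => hT₁ i j m) m
  -- For k ≠ m, two copies of `T m k m` come from block m and one copy of `T m m k` lies in block k.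
  -- Of the resulting 21/10, one unit pays for the first sum and 11/10 is the surplus.
  have h3 : ∀ k ∈ Finset.univ.erase m, 21 / 10 * (∑ i, T i i k) ^ 2 ≤
      2 * T m k m ^ 2 + ∑ i, ∑ j, T i j k ^ 2 + 1000 * M ^ 2 := by
    intro k _
    have hn : 0 ≤ ∑ i, ∑ j, T i j k ^ 2 :=
      Finset.sum_nonneg fun i _ => Finset.sum_nonneg fun j _ => sq_nonneg _
    have hsq := Real.sq_sqrt hn
    have h4 := abs_trace_sub_le (S := fun i j => T i j k) hs0 (by linarith) hms hm (hg k) (hE k)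
      (Real.sqrt_nonneg _) hsq.symm
    have h5 : T m m k ^ 2 ≤ √(∑ i, ∑ j, T i j k ^ 2) ^ 2 := by
      rw [hsq]
      exact (Finset.single_le_sum (f := fun j => T m j k ^ 2) (fun j _ => sq_nonneg _)
        (Finset.mem_univ m)).trans (Finset.single_le_sum (f := fun i => ∑ j, T i j k ^ 2)
          (fun i _ => Finset.sum_nonneg fun j _ => sq_nonneg _) (Finset.mem_univ m))
    have h6 := two_point_one_mul_sq_le h5 h4
    rwa [hsq, hT₂ m m k] at h6
  have h7 := Finset.sum_le_sum h3
  rw [← Finset.mul_sum, Finset.sum_add_distrib, Finset.sum_add_distrib, ← Finset.mul_sum,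
    Finset.sum_const, nsmul_eq_mul] at h7
  have h8 : ((Finset.univ.erase m).card : ℝ) * (1000 * M ^ 2) ≤
      1000 * M ^ 2 * Fintype.card ι * s ^ 2 := by
    have h9 : ((Finset.univ.erase m).card : ℝ) ≤ Fintype.card ι := by
      exact_mod_cast Finset.card_le_univ _
    have h10 : (1 : ℝ) ≤ s ^ 2 := one_le_pow₀ hs1
    calc ((Finset.univ.erase m).card : ℝ) * (1000 * M ^ 2)
        ≤ Fintype.card ι * (1000 * M ^ 2) * 1 := by rw [mul_one]; gcongr
      _ ≤ Fintype.card ι * (1000 * M ^ 2) * s ^ 2 := by gcongr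
      _ = _ := by ring
  have h9 := Finset.add_sum_erase (a := m) _ (fun k => (∑ i, T i i k) ^ 2) (Finset.mem_univ m)
  have h10 := Finset.add_sum_erase (a := m) _ (fun k => ∑ i, ∑ j, T i j k ^ 2)
    (Finset.mem_univ m)
  linarith

/-! ### The two cases at a critical point, and their combination -/

theorem sum_mul_sq_le_of_le {ι : Type*} [Fintype ι] {F r : ι → ℝ} {c D : ℝ} (hF : ∀ k, F k ≤ c)
    (hc : 0 ≤ c) (hr : ∑ k, r k ^ 2 ≤ D) : ∑ k, F k * r k ^ 2 ≤ c * D := by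
  calc ∑ k, F k * r k ^ 2 ≤ ∑ k, c * r k ^ 2 :=
        Finset.sum_le_sum fun k _ => mul_le_mul_of_nonneg_right (hF k) (sq_nonneg _)
    _ = c * ∑ k, r k ^ 2 := by rw [Finset.mul_sum]
    _ ≤ _ := by gcongr

/-- At a maximum of the test function no eigenvalue can be dominated by the trace. -/
theorem false_of_forall_le {ι : Type*} [Fintype ι] {l p r π ξ : ι → ℝ}
    {s a α β c B R t : ℝ} (hs : 0 < s) (hl : ∑ i, l i = s) (hls : ∀ i, |l i| ≤ s)
    (hδ : ∀ i, l i ≤ (1 - 1 / 800) * s) (hp : ∑ i, p i ^ 2 ≤ B ^ 2) (hξ : ∑ i, ξ i ^ 2 ≤ R ^ 2)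
    (hβ : 1 ≤ β) (hπ : ∑ i, (β * π i) ^ 2 ≤ (a * s) ^ 2) (hα : 0 ≤ α) (hR : 0 ≤ R)
    (hαR : α * R ≤ a * s)
    (ha : 0 < a) (hac : a * (20 + 9 * B ^ 2) * Fintype.card ι < 1 / 800) (hc : 0 ≤ c)
    (hr : ∀ k, r k = β * π k - a * l k * p k - α * ξ k) (ht : 0 ≤ t)
    (hmain : t - s * ∑ k, r k ^ 2 - ∑ k, (s - l k) * r k ^ 2 - β * ∑ k, (s - l k) * π k ^ 2 +
      a * ∑ k, (s - l k) * l k ^ 2 + c * s ≤ 0) : False := by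
  have hF : ∀ k, s - l k ≤ 2 * s := fun k => by linarith [neg_le_of_abs_le (hls k)]
  have h1 : ∑ k, r k ^ 2 ≤ 3 * (a * s) ^ 2 * (2 + B ^ 2) := by
    calc ∑ k, r k ^ 2
        ≤ ∑ k, (3 * (β * π k) ^ 2 + 3 * (a * s) ^ 2 * p k ^ 2 + 3 * α ^ 2 * ξ k ^ 2) := by
          refine Finset.sum_le_sum fun k _ => ?_
          have : (a * l k * p k) ^ 2 ≤ (a * s) ^ 2 * p k ^ 2 := by
            rw [mul_pow, mul_pow, mul_pow, ← sq_abs (l k)]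
            have := hls k
            gcongr
          rw [hr k]
          nlinarith [sq_nonneg (β * π k + a * l k * p k), sq_nonneg (β * π k + α * ξ k),
            sq_nonneg (a * l k * p k - α * ξ k)]
      _ = 3 * ∑ k, (β * π k) ^ 2 + 3 * (a * s) ^ 2 * ∑ k, p k ^ 2
            + 3 * α ^ 2 * ∑ k, ξ k ^ 2 := by
          simp only [Finset.sum_add_distrib, Finset.mul_sum]
      _ ≤ 3 * (a * s) ^ 2 + 3 * (a * s) ^ 2 * B ^ 2 + 3 * α ^ 2 * R ^ 2 := by gcongr
      _ ≤ _ := by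
          have : (α * R) ^ 2 ≤ (a * s) ^ 2 := by gcongr
          nlinarith
  have h2 := sum_mul_sq_le_of_le hF (by positivity) h1
  have h3 : β * ∑ k, (s - l k) * π k ^ 2 ≤ 2 * s * (a * s) ^ 2 := by
    calc β * ∑ k, (s - l k) * π k ^ 2 ≤ β * ∑ k, 2 * s * π k ^ 2 := by
          gcongr with k
          exact hF k
      _ = 2 * s * (β * ∑ k, π k ^ 2) := by rw [← Finset.mul_sum]; ring
      _ ≤ 2 * s * (β * (β * ∑ k, π k ^ 2)) := by
          gcongr
          exact le_mul_of_one_le_left (Finset.sum_nonneg fun _ _ => sq_nonneg _) hβ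
      _ = 2 * s * ∑ k, (β * π k) ^ 2 := by simp only [mul_pow, ← Finset.mul_sum]; ring
      _ ≤ _ := by gcongr
  have h4 : s / 800 * ∑ k, l k ^ 2 ≤ ∑ k, (s - l k) * l k ^ 2 := by
    rw [Finset.mul_sum]
    gcongr with k
    linarith [hδ k]
  have h5 : s ^ 2 ≤ Fintype.card ι * ∑ k, l k ^ 2 := by
    rw [← hl]
    exact sq_sum_le_card_mul_sum_sq
  set N : ℝ := (Fintype.card ι : ℝ)
  have hN : 0 ≤ N := Nat.cast_nonneg _
  have h6 : s * ∑ k, r k ^ 2 ≤ s * (3 * (a * s) ^ 2 * (2 + B ^ 2)) := by gcongr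
  -- The constant is 3 · 3(2 + B²) + 2: the sum of r² enters once with weight s and once with weight
  -- at most 2s, and the π term contributes 2.
  have h7 : a * (s / 800 * ∑ k, l k ^ 2) ≤ s ^ 3 * a ^ 2 * (20 + 9 * B ^ 2) := by
    have := mul_le_mul_of_nonneg_left h4 ha.le
    nlinarith [mul_nonneg hc hs.le]
  have h8 : a * s * (s ^ 2 / 800) ≤ a * s * (s ^ 2 * (a * (20 + 9 * B ^ 2) * N)) := by
    calc a * s * (s ^ 2 / 800) ≤ a * s * ((N * ∑ k, l k ^ 2) / 800) := by gcongr
      _ = N * (a * (s / 800 * ∑ k, l k ^ 2)) := by ring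
      _ ≤ N * (s ^ 3 * a ^ 2 * (20 + 9 * B ^ 2)) := by gcongr
      _ = _ := by ring
  have h9 := le_of_mul_le_mul_left h8 (by positivity)
  have h10 : s ^ 2 * (a * (20 + 9 * B ^ 2) * N) < s ^ 2 * (1 / 800) := by gcongr
  linarith

theorem sq_add_add_le (x y z : ℝ) : (x + y + z) ^ 2 ≤ 3 * (x ^ 2 + y ^ 2 + z ^ 2) := by
  nlinarith [sq_nonneg (x - y), sq_nonneg (x - z), sq_nonneg (y - z)]

/-- Used in the directions k ≠ m. Writing βπ² as (βπ)²/β and substituting the first order condition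
gains a factor 1/β, so β ≥ 300 makes the coefficient of r² at most 1/100. -/
theorem mul_sq_le_of_eq_add {l p r π ξ a α β B R : ℝ} (hp : p ^ 2 ≤ B ^ 2) (hξ : ξ ^ 2 ≤ R ^ 2)
    (hβ : 300 ≤ β) (ha : 0 ≤ a) (haB : a * B ^ 2 ≤ 1)
    (hr : r + a * l * p + α * ξ = β * π) :
    β * π ^ 2 ≤ r ^ 2 / 100 + a * l ^ 2 + 3 * α ^ 2 * R ^ 2 / β := by
  have hβ0 : 0 < β := by linarith
  have h1 := sq_add_add_le r (a * l * p) (α * ξ)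
  rw [hr] at h1
  have h3 : β * π ^ 2 = (β * π) ^ 2 / β := by field_simp
  have h5 : (a * l * p) ^ 2 ≤ a * l ^ 2 := by
    calc (a * l * p) ^ 2 = (a * l) ^ 2 * p ^ 2 := by ring
      _ ≤ (a * l) ^ 2 * B ^ 2 := mul_le_mul_of_nonneg_left hp (sq_nonneg _)
      _ = (a * l ^ 2) * (a * B ^ 2) := by ring
      _ ≤ (a * l ^ 2) * 1 := mul_le_mul_of_nonneg_left haB (by positivity)
      _ = _ := mul_one _
  have h7 : (α * ξ) ^ 2 ≤ α ^ 2 * R ^ 2 := by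
    rw [mul_pow]
    exact mul_le_mul_of_nonneg_left hξ (sq_nonneg _)
  have h8 : (r ^ 2 / 100 + a * l ^ 2 + 3 * α ^ 2 * R ^ 2 / β) * β =
    r ^ 2 / 100 * β + a * l ^ 2 * β + 3 * α ^ 2 * R ^ 2 := by field_simp
  rw [h3, div_le_iff₀ hβ0, h8]
  have h9 : r ^ 2 * 300 ≤ r ^ 2 * β := mul_le_mul_of_nonneg_left hβ (sq_nonneg _)
  have h10 : a * l ^ 2 * 300 ≤ a * l ^ 2 * β := mul_le_mul_of_nonneg_left hβ (by positivity)
  linarith [mul_nonneg ha (sq_nonneg l)]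

/-- Used in the dominating direction, where s ≤ 2l makes every term of the first order condition O(a
l). The left side is then O(a² l²), with constant 3(4 + 4 + B²) + 4 = 28 + 3B², and smallness of a
closes the estimate. -/
theorem sq_add_mul_sq_le_of_eq_sub {l p r π ξ s a α β B : ℝ} (hp : p ^ 2 ≤ B ^ 2)
    (hξ : (α * ξ) ^ 2 ≤ (a * s) ^ 2) (hβ : 1 ≤ β) (ha : 0 ≤ a)
    (hac : a * (28 + 3 * B ^ 2) ≤ 1) (hπ : (β * π) ^ 2 ≤ (a * s) ^ 2) (hs : 0 ≤ s)
    (hl : s ≤ 2 * l) (hr : r = β * π - a * l * p - α * ξ) :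
    r ^ 2 + β * π ^ 2 ≤ a * l ^ 2 := by
  have h1 := sq_add_add_le (β * π) (-(a * l * p)) (-(α * ξ))
  rw [← sub_eq_add_neg, ← sub_eq_add_neg, ← hr, neg_sq, neg_sq] at h1
  have h2 : (a * l * p) ^ 2 ≤ (a * l) ^ 2 * B ^ 2 := by
    rw [mul_pow]
    exact mul_le_mul_of_nonneg_left hp (sq_nonneg _)
  have h3 : (a * s) ^ 2 ≤ 4 * (a * l) ^ 2 := by
    have : a * s ≤ a * (2 * l) := mul_le_mul_of_nonneg_left hl ha
    calc (a * s) ^ 2 ≤ (a * (2 * l)) ^ 2 := pow_le_pow_left₀ (by positivity) this 2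
      _ = _ := by ring
  have h4 : β * π ^ 2 ≤ (β * π) ^ 2 := by
    rw [mul_pow]
    exact mul_le_mul_of_nonneg_right (by nlinarith) (sq_nonneg _)
  calc r ^ 2 + β * π ^ 2 ≤ (a * (28 + 3 * B ^ 2)) * (a * l ^ 2) := by linarith
    _ ≤ 1 * (a * l ^ 2) := mul_le_mul_of_nonneg_right hac (by positivity)
    _ = _ := one_mul _

/-- At a maximum of the test function no eigenvalue can dominate. -/
theorem false_of_lt {ι : Type*} [Fintype ι] [DecidableEq ι] {l p r π ξ : ι → ℝ}
    {s a α β c B R t c₂ : ℝ} {m : ι} (hs : 0 < s) (hls : ∑ i, l i ^ 2 < s ^ 2)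
    (hm : (1 - 1 / 800) * s < l m) (hp : ∀ i, p i ^ 2 ≤ B ^ 2) (hξ : ∀ i, ξ i ^ 2 ≤ R ^ 2)
    (hβ : 300 ≤ β) (hβα : 6 * Fintype.card ι * α ^ 2 * R ^ 2 ≤ β)
    (hπ : ∀ i, (β * π i) ^ 2 ≤ (a * s) ^ 2) (hα : 0 ≤ α) (hR : 0 ≤ R) (hαR : α * R ≤ a * s)
    (ha : 0 < a) (hac : a * (28 + 3 * B ^ 2) ≤ 1) (hc : c₂ + 1 < c)
    (hr : ∀ k, r k = β * π k - a * l k * p k - α * ξ k)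
    (ht : s * ∑ k, r k ^ 2 + 11 / 10 * s * ∑ k ∈ Finset.univ.erase m, r k ^ 2 ≤ t + c₂ * s)
    (hmain : t - s * ∑ k, r k ^ 2 - ∑ k, (s - l k) * r k ^ 2 - β * ∑ k, (s - l k) * π k ^ 2 +
      a * ∑ k, (s - l k) * l k ^ 2 + c * s ≤ 0) : False := by
  have hβ0 : 0 < β := by linarith
  have hlm : l m < s := by
    refine lt_of_pow_lt_pow_left₀ 2 hs.le ?_
    exact (Finset.single_le_sum (f := fun i => l i ^ 2) (fun _ _ => sq_nonneg _)
      (Finset.mem_univ m)).trans_lt hls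
  have hsm := Finset.add_sum_erase (a := m) _ (fun i => l i ^ 2) (Finset.mem_univ m)
  have hli : ∀ i ∈ Finset.univ.erase m, |l i| ≤ s / 20 := by
    intro i hi
    refine abs_le_of_sq_le_sq ?_ (by positivity)
    have := Finset.single_le_sum (f := fun i => l i ^ 2) (fun _ _ => sq_nonneg _) hi
    nlinarith
  have hξa : ∀ i, (α * ξ i) ^ 2 ≤ (a * s) ^ 2 := fun i => by
    calc (α * ξ i) ^ 2 = α ^ 2 * ξ i ^ 2 := by ring
      _ ≤ α ^ 2 * R ^ 2 := mul_le_mul_of_nonneg_left (hξ i) (sq_nonneg _)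
      _ = (α * R) ^ 2 := by ring
      _ ≤ _ := by gcongr
  have hM : r m ^ 2 + β * π m ^ 2 ≤ a * l m ^ 2 :=
    sq_add_mul_sq_le_of_eq_sub (hp m) (hξa m) (by linarith) ha.le hac (hπ m) hs.le
      (by linarith) (hr m)
  have haB : a * B ^ 2 ≤ 1 := by nlinarith [mul_nonneg ha.le (sq_nonneg B)]
  have hI : ∀ i ∈ Finset.univ.erase m, (s - l i) * r i ^ 2 + β * ((s - l i) * π i ^ 2) ≤
      11 / 10 * s * r i ^ 2 + a * ((s - l i) * l i ^ 2) + 6 * s * α ^ 2 * R ^ 2 / β := by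
    intro i hi
    have hl1 := abs_le.1 (hli i hi)
    have hFp : 0 ≤ s - l i := by linarith
    have h4 : β * π i ^ 2 ≤ r i ^ 2 / 100 + a * l i ^ 2 + 3 * α ^ 2 * R ^ 2 / β :=
      mul_sq_le_of_eq_add (hp i) (hξ i) hβ ha.le haB (by rw [hr]; ring)
    have h5 := mul_le_mul_of_nonneg_left h4 hFp
    have h6 : (s - l i) * (3 * α ^ 2 * R ^ 2 / β) ≤ 2 * s * (3 * α ^ 2 * R ^ 2 / β) := by
      gcongr
      linarith
    have h7 : (s - l i) * r i ^ 2 ≤ 21 / 20 * s * r i ^ 2 := by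
      gcongr
      linarith
    have h8 : 2 * s * (3 * α ^ 2 * R ^ 2 / β) = 6 * s * α ^ 2 * R ^ 2 / β := by ring
    have h9 : 0 ≤ s * r i ^ 2 := by positivity
    linarith
  have hS := Finset.sum_le_sum hI
  simp only [Finset.sum_add_distrib, ← Finset.mul_sum, Finset.sum_const, nsmul_eq_mul] at hS
  have hcard : ((Finset.univ.erase m).card : ℝ) * (6 * s * α ^ 2 * R ^ 2 / β) ≤ s := by
    calc ((Finset.univ.erase m).card : ℝ) * (6 * s * α ^ 2 * R ^ 2 / β)
        ≤ Fintype.card ι * (6 * s * α ^ 2 * R ^ 2 / β) := by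
          gcongr
          exact Finset.card_le_univ _
      _ = s * (6 * Fintype.card ι * α ^ 2 * R ^ 2 / β) := by ring
      _ ≤ s * 1 := by
          gcongr
          rwa [div_le_one hβ0]
      _ = s := mul_one s
  have hM' := mul_le_mul_of_nonneg_left hM (sub_nonneg.2 hlm.le)
  have e1 := Finset.add_sum_erase (a := m) _ (fun k => (s - l k) * r k ^ 2) (Finset.mem_univ m)
  have e2 := Finset.add_sum_erase (a := m) _ (fun k => (s - l k) * π k ^ 2) (Finset.mem_univ m)
  have e3 := Finset.add_sum_erase (a := m) _ (fun k => (s - l k) * l k ^ 2) (Finset.mem_univ m)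
  rw [← e1, ← e2, ← e3] at hmain
  nlinarith

/-- The sum is (n - 1)s. Dimension at least two is what lets the |x|² part of the test function
contribute a full α s. -/
theorem le_sum_sub_of_two_le_card {ι : Type*} [Fintype ι] {l : ι → ℝ} {s : ℝ} (hl : ∑ i, l i = s)
    (hcard : 2 ≤ Fintype.card ι) (hs : 0 ≤ s) : s ≤ ∑ i, (s - l i) := by
  rw [Finset.sum_sub_distrib, hl, Finset.sum_const, Finset.card_univ, nsmul_eq_mul]
  have : (2 : ℝ) ≤ Fintype.card ι := by exact_mod_cast hcard
  nlinarith

/-- The algebraic heart of the estimate: at an interior maximum of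
`log s + β log w + a/2 |∇u|² + α/2 |x|²`, the trace `s` of the Hessian and `s * w` cannot both be
large. Here `l` are the eigenvalues of the Hessian, `p` is the gradient, `T` the third derivatives,
`q` the second derivatives of the trace, and `g`, `dG` the gradient and Laplacian of the right-hand
side. -/
theorem false_of_critical {ι : Type*} [Fintype ι] [DecidableEq ι] {l p ξ q g : ι → ℝ}
    {T : ι → ι → ι → ℝ} {s w d d₀ dG a α β K M B R : ℝ}
    (hcard : 2 ≤ Fintype.card ι)
    (hT₁ : ∀ i j k, T i j k = T j i k) (hT₂ : ∀ i j k, T i j k = T i k j)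
    (hl : ∑ i, l i = s) (hd : s ^ 2 - ∑ i, l i ^ 2 = d) (hd₀ : 0 < d₀) (hdd : d₀ ≤ d)
    (hdM : d ≤ M) (hM : 0 ≤ M) (hB : 0 ≤ B) (hR : 0 ≤ R)
    (hp : ∑ i, p i ^ 2 ≤ B ^ 2) (hξ : ∑ i, ξ i ^ 2 ≤ R ^ 2)
    (hw : 0 < w) (ha : 0 < a) (hβ : 300 ≤ β)
    (ha₁ : a * (20 + 9 * B ^ 2) * Fintype.card ι < 1 / 800) (ha₂ : a * (28 + 3 * B ^ 2) ≤ 1)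
    (hα : M + M * Fintype.card ι * a * (2 + B) + a * Fintype.card ι * B * M + 3 +
      (M ^ 2 / d₀ + 1000 * M ^ 2 * Fintype.card ι) ≤ α)
    (hβα : 6 * Fintype.card ι * α ^ 2 * R ^ 2 ≤ β)
    (hK₁ : β * B ≤ a * K) (hK₂ : α * R ≤ a * K) (hK₃ : β * M ≤ K) (hK₄ : 1 ≤ K)
    (hsK : K ≤ s) (hswK : K ≤ s * w)
    (hE : ∀ k, ∑ i, (s - l i) * T i i k = g k) (hg : ∀ k, |g k| ≤ M * s)
    (hE₂ : ∑ k, (s - l k) * q k =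
      dG + ∑ k, ∑ i, ∑ j, T i j k ^ 2 - ∑ k, (∑ i, T i i k) ^ 2)
    (hdG : -(M * s ^ 2) - M * ∑ k, |∑ i, T i i k| ≤ dG)
    (hcrit : ∀ k, (∑ i, T i i k) / s = β * (p k / w) - a * l k * p k - α * ξ k)
    (hsecond : ∀ k, q k / s - ((∑ i, T i i k) / s) ^ 2 + β * (-(l k / w) - (p k / w) ^ 2) +
      a * (l k ^ 2 + ∑ j, p j * T j k k) + α ≤ 0) : False := by
  set N : ℝ := (Fintype.card ι : ℝ) with hN
  have hN0 : 0 ≤ N := Nat.cast_nonneg _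
  have hs1 : 1 ≤ s := hK₄.trans hsK
  have hs : 0 < s := by linarith
  have hβ0 : 0 < β := by linarith
  set C₂ := M ^ 2 / d₀ + 1000 * M ^ 2 * N with hC₂
  have hC₂0 : 0 ≤ C₂ := by positivity
  have hC₁0 : 0 ≤ M + M * N * a * (2 + B) + a * N * B * M := by positivity
  have hα0 : 0 ≤ α := by linarith
  have hls2 : ∑ i, l i ^ 2 < s ^ 2 := by linarith
  have hli : ∀ i, |l i| ≤ s := fun i => by
    refine abs_le_of_sq_le_sq ?_ hs.le
    exact (Finset.single_le_sum (f := fun i => l i ^ 2) (fun _ _ => sq_nonneg _)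
      (Finset.mem_univ i)).trans hls2.le
  have hF : ∀ i, 0 ≤ s - l i := fun i => by linarith [le_of_abs_le (hli i)]
  have hpi : ∀ i, p i ^ 2 ≤ B ^ 2 := fun i =>
    (Finset.single_le_sum (f := fun i => p i ^ 2) (fun _ _ => sq_nonneg _)
      (Finset.mem_univ i)).trans hp
  have hξi : ∀ i, ξ i ^ 2 ≤ R ^ 2 := fun i =>
    (Finset.single_le_sum (f := fun i => ξ i ^ 2) (fun _ _ => sq_nonneg _)
      (Finset.mem_univ i)).trans hξ
  -- The lower bound on s w converts each 1/w into a multiple of s that is small when K is large.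
  have hw1 : 1 / w ≤ s / K := by
    rw [div_le_div_iff₀ hw (by linarith)]
    linarith
  have hβw : β * B * (1 / w) ≤ a * s := by
    calc β * B * (1 / w) ≤ a * K * (s / K) := by gcongr
      _ = a * s := by field_simp
  have hπsum : ∑ i, (β * (p i / w)) ^ 2 ≤ (a * s) ^ 2 := by
    calc ∑ i, (β * (p i / w)) ^ 2 = (β * (1 / w)) ^ 2 * ∑ i, p i ^ 2 := by
          rw [Finset.mul_sum]
          exact Finset.sum_congr rfl fun i _ => by ring
      _ ≤ (β * (1 / w)) ^ 2 * B ^ 2 := by gcongr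
      _ = (β * B * (1 / w)) ^ 2 := by ring
      _ ≤ _ := by gcongr
  have hπi : ∀ i, (β * (p i / w)) ^ 2 ≤ (a * s) ^ 2 := fun i =>
    (Finset.single_le_sum (f := fun i => (β * (p i / w)) ^ 2) (fun _ _ => sq_nonneg _)
      (Finset.mem_univ i)).trans hπsum
  have hαR : α * R ≤ a * s := hK₂.trans (by gcongr)
  set r : ι → ℝ := fun k => (∑ i, T i i k) / s with hr
  have hσr : ∀ k, ∑ i, T i i k = s * r k := fun k => by simp only [hr]; field_simp
  have hrabs : ∀ k, |r k| ≤ a * (2 + B) * s := by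
    intro k
    have h1 : r k = β * (p k / w) - a * l k * p k - α * ξ k := hcrit k
    have h2 : |β * (p k / w)| ≤ a * s := abs_le_of_sq_le_sq (hπi k) (by positivity)
    have h3 : |a * l k * p k| ≤ a * s * B := by
      rw [abs_mul, abs_mul, abs_of_pos ha]
      have := abs_le_of_sq_le_sq (hpi k) hB
      have := hli k
      gcongr
    have h4 : |α * ξ k| ≤ a * s := by
      rw [abs_mul, abs_of_nonneg hα0]
      have := abs_le_of_sq_le_sq (hξi k) hR
      exact le_trans (by gcongr) hαR
    rw [h1]
    have := abs_sub (β * (p k / w) - a * l k * p k) (α * ξ k)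
    have := abs_sub (β * (p k / w)) (a * l k * p k)
    linarith
  set t := (∑ k, ∑ i, ∑ j, T i j k ^ 2) / s with ht
  have ht0 : 0 ≤ t := div_nonneg (Finset.sum_nonneg fun _ _ => Finset.sum_nonneg fun _ _ =>
    Finset.sum_nonneg fun _ _ => sq_nonneg _) hs.le
  -- sum the second order conditions
  have hsum : ∑ k, (s - l k) * (q k / s - r k ^ 2 + β * (-(l k / w) - (p k / w) ^ 2) +
      a * (l k ^ 2 + ∑ j, p j * T j k k) + α) ≤ 0 :=
    Finset.sum_nonpos fun k _ => mul_nonpos_of_nonneg_of_nonpos (hF k) (hsecond k)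
  have hexp : ∀ Y : ι → ℝ, ∑ k, (s - l k) * (q k / s - r k ^ 2 +
      β * (-(l k / w) - (p k / w) ^ 2) + a * (l k ^ 2 + Y k) + α) =
      (∑ k, (s - l k) * q k) / s - ∑ k, (s - l k) * r k ^ 2 - β * ((∑ k, (s - l k) * l k) / w)
      - β * ∑ k, (s - l k) * (p k / w) ^ 2 + a * ∑ k, (s - l k) * l k ^ 2
      + a * ∑ k, (s - l k) * Y k + α * ∑ k, (s - l k) := by
    intro Y
    simp only [Finset.mul_sum, Finset.sum_div, ← Finset.sum_sub_distrib, ← Finset.sum_add_distrib]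
    exact Finset.sum_congr rfl fun k _ => by ring
  -- Homogeneity of σ₂: the Hessian part of log w contributes only βd/w, which is at most s.
  have h1 : ∑ k, (s - l k) * l k = d := by
    rw [← hd]
    simp only [sub_mul, Finset.sum_sub_distrib, ← Finset.mul_sum, hl]
    ring_nf
  have h2 : β * (d / w) ≤ s := by
    calc β * (d / w) = β * d * (1 / w) := by ring
      _ ≤ β * M * (s / K) := by gcongr
      _ ≤ K * (s / K) := by gcongr
      _ = s := by field_simp
  -- The third derivatives produced by |∇u|² collapse through the once differentiated equation, so
  -- they cost only O(s).
  have h3 : ∑ k, (s - l k) * ∑ j, p j * T j k k = ∑ j, p j * g j := by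
    simp only [← hE, Finset.mul_sum]
    rw [Finset.sum_comm]
    refine Finset.sum_congr rfl fun j _ => Finset.sum_congr rfl fun k _ => ?_
    rw [hT₁ j k k, hT₂ k j k]
    ring
  have h4 : -(N * (B * (M * s))) ≤ ∑ j, p j * g j := by
    have : ∑ j : ι, -(B * (M * s)) ≤ ∑ j, p j * g j := by
      refine Finset.sum_le_sum fun j _ => neg_le_of_abs_le ?_
      rw [abs_mul]
      have := abs_le_of_sq_le_sq (hpi j) hB
      have := hg j
      gcongr
    rw [Finset.sum_const, Finset.card_univ, nsmul_eq_mul] at this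
    linarith
  have h5 := le_sum_sub_of_two_le_card hl hcard hs.le
  have h6 : (∑ k, (s - l k) * q k) / s = dG / s + t - s * ∑ k, r k ^ 2 := by
    have : ∑ k, (∑ i, T i i k) ^ 2 = s * (s * ∑ k, r k ^ 2) := by
      simp only [hσr, mul_pow, ← Finset.mul_sum]
      ring
    rw [hE₂, ht, this]
    field_simp
  have h7 : -(M * s) - M * (N * (a * (2 + B) * s)) ≤ dG / s := by
    rw [le_div_iff₀ hs]
    have h8 : ∑ k, |∑ i, T i i k| ≤ s * (N * (a * (2 + B) * s)) := by
      have : ∑ k, |∑ i, T i i k| ≤ ∑ k : ι, s * (a * (2 + B) * s) := by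
        refine Finset.sum_le_sum fun k _ => ?_
        rw [hσr, abs_mul, abs_of_pos hs]
        exact mul_le_mul_of_nonneg_left (hrabs k) hs.le
      rw [Finset.sum_const, Finset.card_univ, nsmul_eq_mul] at this
      linarith
    have := mul_le_mul_of_nonneg_left h8 hM
    linarith
  have hα' : α * s ≤ α * ∑ k, (s - l k) := by gcongr
  have h4' := mul_le_mul_of_nonneg_left h4 ha.le
  rw [hexp fun k => ∑ j, p j * T j k k, h1, h3, h6] at hsum
  -- What is left of α after all lower order terms are paid; the lower bound on α gives c ≥ C₂ + 2,
  -- enough for both cases.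
  set c := α - (M + M * N * a * (2 + B) + a * N * B * M + 1) with hc
  have hmain : t - s * ∑ k, r k ^ 2 - ∑ k, (s - l k) * r k ^ 2
      - β * ∑ k, (s - l k) * (p k / w) ^ 2 + a * ∑ k, (s - l k) * l k ^ 2 + c * s ≤ 0 := by
    have : c * s = α * s - (M * s + M * (N * (a * (2 + B) * s)) + a * (N * (B * (M * s))) + s) := by
      rw [hc]; ring
    linarith
  by_cases hcase : ∀ i, l i ≤ (1 - 1 / 800) * s
  · exact false_of_forall_le hs hl hli hcase hp hξ (by linarith) hπsum hα0 hR hαR ha ha₁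
      (by linarith) hcrit ht0 hmain
  · push Not at hcase
    obtain ⟨m, hm⟩ := hcase
    have h8 := third_order_le hT₁ hT₂ hs1 hd hd₀ hdd (le_of_abs_le (hli m)) hm hg hE
    refine false_of_lt hs hls2 hm hpi hξi hβ hβα hπi hα0 hR hαR ha ha₂
      (c₂ := C₂) (by linarith) hcrit ?_ hmain
    simp only [hσr, mul_pow, ← Finset.mul_sum] at h8
    rw [ht, ← mul_le_mul_iff_of_pos_left hs, mul_add, mul_add, mul_div_cancel₀ _ hs.ne']
    linarith

/-! ### Calculus along a line -/

open Filter Topology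

/-- First and second order conditions at a local maximum on the line. -/
theorem IsLocalMax.hasDerivAt_eq_zero_and_nonpos {g g' : ℝ → ℝ} {c x : ℝ}
    (hmax : IsLocalMax g x) (hg : ∀ᶠ t in 𝓝 x, HasDerivAt g (g' t) t)
    (hg' : HasDerivAt g' c x) : g' x = 0 ∧ c ≤ 0 := by
  have h0 : g' x = 0 := hmax.hasDerivAt_eq_zero hg.self_of_nhds
  refine ⟨h0, ?_⟩
  by_contra! hc
  have hd : deriv g =ᶠ[𝓝 x] g' := hg.mono fun t ht => ht.deriv
  -- A positive second derivative would make the point a local minimum as well, so `g` would be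
  -- locally constant and its second derivative zero.
  have hmin : IsLocalMin g x := by
    refine isLocalMin_of_deriv_deriv_pos ?_ (by rw [hd.self_of_nhds, h0])
      hg.self_of_nhds.continuousAt
    rwa [hd.deriv_eq, hg'.deriv]
  have hconst : g =ᶠ[𝓝 x] fun _ => g x := by
    filter_upwards [hmin, hmax] with t h1 h2
    exact le_antisymm h2 h1
  have hd0 : g' =ᶠ[𝓝 x] fun _ => 0 := by
    filter_upwards [hd, hconst.eventuallyEq_nhds] with t h1 h2
    rw [← h1, h2.deriv_eq, deriv_const]
  have : c = 0 := by
    rw [← hg'.deriv, hd0.deriv_eq, deriv_const]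
  exact hc.ne' this

theorem HasDerivAt.fun_sq {f : ℝ → ℝ} {f' t : ℝ} (h : HasDerivAt f f' t) :
    HasDerivAt (fun t => f t ^ 2) (2 * (f t * f')) t :=
  (h.fun_pow 2).congr_deriv (by push_cast; ring)

/-- First and second order conditions for the logarithmic test function along a line. -/
theorem test_function_conditions {ι E : Type*} [Fintype ι] [NormedAddCommGroup E]
    [InnerProductSpace ℝ E] {S S₁ W W₁ : ℝ → ℝ} {P P₁ : ι → ℝ → ℝ} {P₂ : ι → ℝ}
    {S₂ W₂ a α β : ℝ} {x v : E} (hv : ‖v‖ = 1)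
    (hS : ∀ᶠ t in 𝓝 (0 : ℝ), HasDerivAt S (S₁ t) t) (hS₁ : HasDerivAt S₁ S₂ 0) (hS0 : 0 < S 0)
    (hW : ∀ᶠ t in 𝓝 (0 : ℝ), HasDerivAt W (W₁ t) t) (hW₁ : HasDerivAt W₁ W₂ 0) (hW0 : 0 < W 0)
    (hP : ∀ j, ∀ᶠ t in 𝓝 (0 : ℝ), HasDerivAt (P j) (P₁ j t) t)
    (hP₁ : ∀ j, HasDerivAt (P₁ j) (P₂ j) 0)
    (hmax : IsLocalMax (fun t => Real.log (S t) + β * Real.log (W t) + a / 2 * ∑ j, P j t ^ 2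
      + α / 2 * ‖x + t • v‖ ^ 2) 0) :
    S₁ 0 / S 0 + β * (W₁ 0 / W 0) + a * ∑ j, P j 0 * P₁ j 0 + α * ⟪x, v⟫_ℝ = 0 ∧
    S₂ / S 0 - (S₁ 0 / S 0) ^ 2 + β * (W₂ / W 0 - (W₁ 0 / W 0) ^ 2) +
      a * ∑ j, (P₁ j 0 ^ 2 + P j 0 * P₂ j) + α ≤ 0 := by
  have hSc := hS.self_of_nhds.continuousAt.eventually_ne hS0.ne'
  have hWc := hW.self_of_nhds.continuousAt.eventually_ne hW0.ne'
  have hQ : (fun t : ℝ => ‖x + t • v‖ ^ 2) = fun t => ‖x‖ ^ 2 + 2 * (t * ⟪x, v⟫_ℝ) + t ^ 2 := by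
    ext t
    rw [norm_add_sq_real, inner_smul_right, norm_smul, hv, mul_one, Real.norm_eq_abs, sq_abs]
  have hQ' : ∀ t : ℝ, HasDerivAt (fun t : ℝ => ‖x + t • v‖ ^ 2) (2 * ⟪x, v⟫_ℝ + 2 * t) t := by
    intro t
    rw [hQ]
    have h1 : HasDerivAt (fun t : ℝ => ‖x‖ ^ 2 + 2 * (t * ⟪x, v⟫_ℝ) + t ^ 2)
        (2 * (1 * ⟪x, v⟫_ℝ) + (2 : ℕ) * t ^ 1 * 1) t :=
      ((((hasDerivAt_id' t).mul_const _).const_mul 2).const_add _).add ((hasDerivAt_id' t).pow 2)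
    convert h1 using 1
    push_cast
    ring
  have key := hmax.hasDerivAt_eq_zero_and_nonpos
    (g' := fun t => S₁ t / S t + β * (W₁ t / W t) + a / 2 * ∑ j, 2 * (P j t * P₁ j t)
      + α / 2 * (2 * ⟪x, v⟫_ℝ + 2 * t))
    (c := (S₂ * S 0 - S₁ 0 * S₁ 0) / S 0 ^ 2 + β * ((W₂ * W 0 - W₁ 0 * W₁ 0) / W 0 ^ 2) +
      a / 2 * ∑ j, 2 * (P₁ j 0 * P₁ j 0 + P j 0 * P₂ j) + α / 2 * (2 * 1)) ?_ ?_
  · obtain ⟨h1, h2⟩ := key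
    constructor
    · rw [← Finset.mul_sum] at h1
      linarith
    · convert h2 using 1
      rw [← Finset.mul_sum]
      simp only [pow_two]
      field_simp
  · filter_upwards [hS, hW, eventually_all.2 hP, hSc, hWc] with t h1 h2 h3 h4 h5
    refine (((h1.log h4).add ((h2.log h5).const_mul β)).add
      (HasDerivAt.const_mul (a / 2) (HasDerivAt.fun_sum fun j _ => (h3 j).fun_sq))).add
        ((hQ' t).const_mul (α / 2))
  · refine (((hS₁.div hS.self_of_nhds hS0.ne').add
      ((hW₁.div hW.self_of_nhds hW0.ne').const_mul β)).add
      (HasDerivAt.const_mul (a / 2) (HasDerivAt.fun_sum fun j _ => ?_))).add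
        (HasDerivAt.const_mul (α / 2) (((hasDerivAt_id' 0).const_mul 2).const_add _))
    exact ((hP j).self_of_nhds.fun_mul (hP₁ j)).const_mul 2

/-- Differentiating `S² - ∑ U² = 2 G` twice along a line. -/
theorem derivatives_of_equation {ι : Type*} [Fintype ι] {S S₁ G G₁ : ℝ → ℝ}
    {U U₁ : ι → ι → ℝ → ℝ} {U₂ : ι → ι → ℝ} {S₂ G₂ : ℝ}
    (hS : ∀ᶠ t in 𝓝 (0 : ℝ), HasDerivAt S (S₁ t) t) (hS₁ : HasDerivAt S₁ S₂ 0)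
    (hG : ∀ᶠ t in 𝓝 (0 : ℝ), HasDerivAt G (G₁ t) t) (hG₁ : HasDerivAt G₁ G₂ 0)
    (hU : ∀ i j, ∀ᶠ t in 𝓝 (0 : ℝ), HasDerivAt (U i j) (U₁ i j t) t)
    (hU₁ : ∀ i j, HasDerivAt (U₁ i j) (U₂ i j) 0)
    (heq : ∀ᶠ t in 𝓝 (0 : ℝ), S t ^ 2 - ∑ i, ∑ j, U i j t ^ 2 = 2 * G t) :
    S 0 * S₁ 0 - ∑ i, ∑ j, U i j 0 * U₁ i j 0 = G₁ 0 ∧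
    S₁ 0 ^ 2 + S 0 * S₂ - ∑ i, ∑ j, (U₁ i j 0 ^ 2 + U i j 0 * U₂ i j) = G₂ := by
  have hU' := eventually_all.2 fun i => eventually_all.2 (hU i)
  have h1 : ∀ᶠ t in 𝓝 (0 : ℝ), S t * S₁ t - ∑ i, ∑ j, U i j t * U₁ i j t = G₁ t := by
    filter_upwards [hS, hG, hU', heq.eventually_nhds] with t hSt hGt hUt ht
    have h2 : HasDerivAt (fun t => S t ^ 2 - ∑ i, ∑ j, U i j t ^ 2)
        (2 * (S t * S₁ t) - ∑ i, ∑ j, 2 * (U i j t * U₁ i j t)) t := by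
      exact hSt.fun_sq.sub
        (HasDerivAt.fun_sum fun i _ => HasDerivAt.fun_sum fun j _ => (hUt i j).fun_sq)
    have h3 := (h2.congr_of_eventuallyEq (EventuallyEq.symm ht)).unique (hGt.const_mul 2)
    simp only [← Finset.mul_sum] at h3
    linarith
  refine ⟨h1.self_of_nhds, ?_⟩
  have h2 : HasDerivAt (fun t => S t * S₁ t - ∑ i, ∑ j, U i j t * U₁ i j t)
      ((S₁ 0 * S₁ 0 + S 0 * S₂) - ∑ i, ∑ j, (U₁ i j 0 * U₁ i j 0 + U i j 0 * U₂ i j)) 0 :=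
    (hS.self_of_nhds.mul hS₁).sub (HasDerivAt.fun_sum fun i _ => HasDerivAt.fun_sum fun j _ =>
      (hU i j).self_of_nhds.mul (hU₁ i j))
  have h3 := (h2.congr_of_eventuallyEq (EventuallyEq.symm h1)).unique hG₁
  simpa only [pow_two] using h3

/-- The second derivative of a composition with a curve. -/
theorem hasDerivAt_comp_curve_twice {F : Type*} [NormedAddCommGroup F] [NormedSpace ℝ F]
    {f : F → ℝ} {γ γ₁ : ℝ → F} {γ₂ : F} (hf : ContDiffAt ℝ 2 f (γ 0))
    (hγ : ∀ᶠ t in 𝓝 (0 : ℝ), HasDerivAt γ (γ₁ t) t) (hγ₁ : HasDerivAt γ₁ γ₂ 0) :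
    (∀ᶠ t in 𝓝 (0 : ℝ), HasDerivAt (fun t => f (γ t)) (fderiv ℝ f (γ t) (γ₁ t)) t) ∧
    HasDerivAt (fun t => fderiv ℝ f (γ t) (γ₁ t))
      (fderiv ℝ (fderiv ℝ f) (γ 0) (γ₁ 0) (γ₁ 0) + fderiv ℝ f (γ 0) γ₂) 0 := by
  constructor
  · have h1 := hγ.self_of_nhds.continuousAt.eventually (hf.eventually (by simp))
    filter_upwards [h1, hγ] with t h2 h3
    exact ((h2.differentiableAt (by simp)).hasFDerivAt).comp_hasDerivAt t h3
  · have h1 : DifferentiableAt ℝ (fderiv ℝ f) (γ 0) :=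
      (hf.fderiv_right (m := 1) (by norm_num)).differentiableAt (by simp)
    exact (h1.hasFDerivAt.comp_hasDerivAt 0 hγ.self_of_nhds).clm_apply hγ₁

/-! ### Directional derivatives -/

/-- The derivative of `g` in the direction `v`. -/
noncomputable def dirDeriv {E : Type*} [NormedAddCommGroup E] [NormedSpace ℝ E] (v : E)
    (g : E → ℝ) (x : E) : ℝ :=
  fderiv ℝ g x v

section dirDeriv

variable {E : Type*} [NormedAddCommGroup E] [NormedSpace ℝ E] {Ω : Set E} {g h : E → ℝ} {x v w : E}

theorem ContDiffOn.dirDeriv {m k : WithTop ℕ∞} (hg : ContDiffOn ℝ k g Ω) (hΩ : IsOpen Ω)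
    (hk : m + 1 ≤ k) (v : E) : ContDiffOn ℝ m (dirDeriv v g) Ω :=
  (hg.fderiv_of_isOpen hΩ hk).clm_apply contDiffOn_const

/-- Openness turns equality on Ω into equality of germs; this lets the commutation identities be
differentiated again. -/
theorem Set.EqOn.dirDeriv (hgh : Set.EqOn g h Ω) (hΩ : IsOpen Ω) (v : E) :
    Set.EqOn (dirDeriv v g) (dirDeriv v h) Ω := fun x hx => by
  have : g =ᶠ[𝓝 x] h := hgh.eventuallyEq_of_mem (hΩ.mem_nhds hx)
  simp only [_root_.dirDeriv, this.fderiv_eq]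

theorem dirDeriv_dirDeriv (hg : ContDiffAt ℝ 2 g x) (v w : E) :
    dirDeriv w (dirDeriv v g) x = fderiv ℝ (fderiv ℝ g) x w v := by
  have h1 : DifferentiableAt ℝ (fderiv ℝ g) x :=
    (hg.fderiv_right (m := 1) (by norm_num)).differentiableAt (by simp)
  have h2 : HasFDerivAt (dirDeriv v g) ((fderiv ℝ (fderiv ℝ g) x).flip v) x := by
    simpa using! h1.hasFDerivAt.clm_apply (hasFDerivAt_const v x)
  rw [dirDeriv, h2.fderiv, ContinuousLinearMap.flip_apply]

theorem dirDeriv_comm (hg : ContDiffOn ℝ 2 g Ω) (hΩ : IsOpen Ω) (v w : E) :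
    Set.EqOn (dirDeriv w (dirDeriv v g)) (dirDeriv v (dirDeriv w g)) Ω := fun x hx => by
  have h1 : ContDiffAt ℝ 2 g x := hg.contDiffAt (hΩ.mem_nhds hx)
  rw [dirDeriv_dirDeriv h1, dirDeriv_dirDeriv h1]
  exact h1.isSymmSndFDerivAt (by simp) w v

theorem hasDerivAt_line (hg : ContDiffOn ℝ 1 g Ω) (hΩ : IsOpen Ω) {t : ℝ} (ht : x + t • v ∈ Ω) :
    HasDerivAt (fun t : ℝ => g (x + t • v)) (dirDeriv v g (x + t • v)) t := by
  have h1 : HasFDerivAt g (fderiv ℝ g (x + t • v)) (x + t • v) :=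
    ((hg.contDiffAt (hΩ.mem_nhds ht)).differentiableAt (by simp)).hasFDerivAt
  have h2 : HasDerivAt (fun t : ℝ => x + t • v) v t := by
    simpa using ((hasDerivAt_id' t).smul_const v).const_add x
  exact h1.comp_hasDerivAt t h2

theorem eventually_line_mem (hΩ : IsOpen Ω) (hx : x ∈ Ω) :
    ∀ᶠ t : ℝ in 𝓝 0, x + t • v ∈ Ω := by
  have : ContinuousAt (fun t : ℝ => x + t • v) 0 := by fun_prop
  exact this.eventually (hΩ.mem_nhds (by simpa using hx))

theorem eventually_hasDerivAt_line (hg : ContDiffOn ℝ 1 g Ω) (hΩ : IsOpen Ω) (hx : x ∈ Ω) :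
    ∀ᶠ t : ℝ in 𝓝 0, HasDerivAt (fun t : ℝ => g (x + t • v)) (dirDeriv v g (x + t • v)) t :=
  (eventually_line_mem hΩ hx).mono fun _ ht => hasDerivAt_line hg hΩ ht

theorem hasDerivAt_line_zero (hg : ContDiffOn ℝ 1 g Ω) (hΩ : IsOpen Ω) (hx : x ∈ Ω) :
    HasDerivAt (fun t : ℝ => g (x + t • v)) (dirDeriv v g x) 0 := by
  simpa using hasDerivAt_line (t := 0) (v := v) hg hΩ (by simpa using hx)

end dirDeriv

/-! ### Symmetric functions of the eigenvalues of the Hessian -/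

namespace HessianEq

theorem sigma_one {n : ℕ} (κ : Fin n → ℝ) : sigma 1 κ = ∑ i, κ i := by
  simp [sigma, Finset.powersetCard_one]

theorem two_mul_sigma_two {n : ℕ} (κ : Fin n → ℝ) :
    2 * sigma 2 κ = (∑ i, κ i) ^ 2 - ∑ i, κ i ^ 2 := by
  -- Stated over every finite index set for induction: adjoining an index `a` adds `2 * κ a * ∑ κ`
  -- to both sides.
  have key : ∀ s : Finset (Fin n), 2 * ∑ t ∈ s.powersetCard 2, ∏ i ∈ t, κ i =
      (∑ i ∈ s, κ i) ^ 2 - ∑ i ∈ s, κ i ^ 2 := by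
    intro s
    induction s using Finset.induction_on with
    | empty =>
      rw [Finset.powersetCard_eq_empty.2 (by simp)]
      simp
    | insert a s ha ih =>
      have hdisj : Disjoint (s.powersetCard 2) ((s.powersetCard 1).image (insert a)) := by
        rw [Finset.disjoint_left]
        intro t ht ht'
        obtain ⟨r, -, rfl⟩ := Finset.mem_image.1 ht'
        exact ha ((Finset.mem_powersetCard.1 ht).1 (Finset.mem_insert_self a r))
      rw [Finset.powersetCard_succ_insert ha, Finset.sum_union hdisj, mul_add, ih,
        Finset.sum_insert ha, Finset.sum_insert ha, Finset.sum_image]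
      · rw [Finset.powersetCard_one, Finset.sum_map]
        have : ∑ i ∈ s, ∏ j ∈ insert a ({i} : Finset (Fin n)), κ j = κ a * ∑ i ∈ s, κ i := by
          rw [Finset.mul_sum]
          refine Finset.sum_congr rfl fun i hi => ?_
          rw [Finset.prod_pair]
          rintro rfl
          exact ha hi
        simp only [Function.Embedding.coeFn_mk]
        rw [this]
        ring
      · intro t ht r hr htr
        have h1 : a ∉ t := fun h => ha ((Finset.mem_powersetCard.1 ht).1 h)
        have h2 : a ∉ r := fun h => ha ((Finset.mem_powersetCard.1 hr).1 h)
        rw [← Finset.erase_insert h1, htr, Finset.erase_insert h2]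
  exact key Finset.univ

/-- This is the basis independence of the Hilbert–Schmidt norm: Parseval changes the basis in one
slot, and symmetry brings the other slot into position. -/
theorem sum_bilin_sq_eq {ι E : Type*} [Fintype ι] [NormedAddCommGroup E] [InnerProductSpace ℝ E]
    (D : E →L[ℝ] E →L[ℝ] ℝ) (hD : ∀ v w, D v w = D w v)
    (b c : OrthonormalBasis ι ℝ E) :
    ∑ i, ∑ j, D (b i) (b j) ^ 2 = ∑ i, ∑ j, D (c i) (c j) ^ 2 := by
  calc ∑ i, ∑ j, D (b i) (b j) ^ 2 = ∑ i, ∑ j, D (b i) (c j) ^ 2 := by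
        simp only [← OrthonormalBasis.norm_dual]
    _ = ∑ j, ∑ i, D (c j) (b i) ^ 2 := by
        rw [Finset.sum_comm]
        simp only [hD]
    _ = _ := by simp only [← OrthonormalBasis.norm_dual]

/-- The spectral theorem for the Hessian matrix, transferred to the second derivative as a bilinear
form and indexed compatibly with `hessianEigenvalues`. -/
theorem exists_orthonormalBasis_hessian {n : ℕ} {u : EuclideanSpace ℝ (Fin n) → ℝ}
    {x : EuclideanSpace ℝ (Fin n)} (hu : ContDiffAt ℝ 2 u x) :
    ∃ c : OrthonormalBasis (Fin n) ℝ (EuclideanSpace ℝ (Fin n)), ∀ i j,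
      fderiv ℝ (fderiv ℝ u) x (c i) (c j) = if i = j then hessianEigenvalues u x i else 0 := by
  have hH := hessian_isHermitian hu
  refine ⟨hH.eigenvectorBasis, fun i j => ?_⟩
  set c := hH.eigenvectorBasis
  set D := fderiv ℝ (fderiv ℝ u) x
  have h1 : ∀ v w : EuclideanSpace ℝ (Fin n), D v w = (v : Fin n → ℝ) ⬝ᵥ (hessian u x).mulVec w := by
    intro v w
    have hv := (EuclideanSpace.basisFun (Fin n) ℝ).sum_repr v
    have hw := (EuclideanSpace.basisFun (Fin n) ℝ).sum_repr w
    conv_lhs => rw [← hv, ← hw]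
    simp only [EuclideanSpace.basisFun_repr, EuclideanSpace.basisFun_apply, map_sum, map_smul,
      sum_apply, smul_apply, smul_eq_mul, dotProduct,
      Matrix.mulVec, hessian, Matrix.of_apply, Finset.mul_sum]
    rw [Finset.sum_comm]
    refine Finset.sum_congr rfl fun i _ => Finset.sum_congr rfl fun j _ => ?_
    ring
  have h2 : (c i : Fin n → ℝ) ⬝ᵥ (c j : Fin n → ℝ) = if i = j then 1 else 0 := by
    rw [← c.inner_eq_ite, PiLp.inner_apply]
    simp only [dotProduct, RCLike.inner_apply, conj_trivial]
    exact Finset.sum_congr rfl fun _ _ => mul_comm _ _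
  rw [h1, hH.mulVec_eigenvectorBasis, dotProduct_smul, h2, hessianEigenvalues, dif_pos hH]
  split_ifs with hij
  · rw [hij, smul_eq_mul, mul_one]
  · rw [smul_zero]

theorem laplacian_eq_sum {n : ℕ} (u : EuclideanSpace ℝ (Fin n) → ℝ)
    (x : EuclideanSpace ℝ (Fin n))
    (b : OrthonormalBasis (Fin n) ℝ (EuclideanSpace ℝ (Fin n))) :
    Laplacian.laplacian u x = ∑ i, fderiv ℝ (fderiv ℝ u) x (b i) (b i) := by
  rw [InnerProductSpace.laplacian_eq_iteratedFDeriv_orthonormalBasis u b]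
  simp [iteratedFDeriv_two_apply]

theorem sum_hessianEigenvalues {n : ℕ} {u : EuclideanSpace ℝ (Fin n) → ℝ}
    {x : EuclideanSpace ℝ (Fin n)} (hu : ContDiffAt ℝ 2 u x) :
    ∑ i, hessianEigenvalues u x i = Laplacian.laplacian u x := by
  obtain ⟨c, hc⟩ := exists_orthonormalBasis_hessian hu
  simp [laplacian_eq_sum u x c, hc]

/-- `2 σ₂(D²u) = (Δu)² - |D²u|²` in any orthonormal frame. -/
theorem two_mul_sigma_two_hessian {n : ℕ} {u : EuclideanSpace ℝ (Fin n) → ℝ}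
    {x : EuclideanSpace ℝ (Fin n)} (hu : ContDiffAt ℝ 2 u x)
    (b : OrthonormalBasis (Fin n) ℝ (EuclideanSpace ℝ (Fin n))) :
    2 * sigma 2 (hessianEigenvalues u x) =
      Laplacian.laplacian u x ^ 2 - ∑ i, ∑ j, fderiv ℝ (fderiv ℝ u) x (b i) (b j) ^ 2 := by
  obtain ⟨c, hc⟩ := exists_orthonormalBasis_hessian hu
  rw [two_mul_sigma_two, sum_hessianEigenvalues hu,
    sum_bilin_sq_eq _ (fun v w => hu.isSymmSndFDerivAt (by simp) v w) b c]
  simp [hc]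

end HessianEq

/-! ### Uniform bounds for f, the sign of u, and the choice of constants -/

/-- A function that is `C²` up to the boundary has bounded derivatives on the part of an open set
that lies in a compact set. -/
theorem ContDiffOn.exists_bound_derivatives {F : Type*} [NormedAddCommGroup F] [NormedSpace ℝ F]
    {f : F → ℝ} {S O K : Set F} (hf : ContDiffOn ℝ 2 f S) (hO : IsOpen O) (hOS : O ⊆ S)
    (hK : IsCompact K) (hKS : K ⊆ S) :
    ∃ M, 0 ≤ M ∧ ∀ y ∈ K, y ∈ O →
      |f y| ≤ M ∧ ‖fderiv ℝ f y‖ ≤ M ∧ ‖fderiv ℝ (fderiv ℝ f) y‖ ≤ M := by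
  refine hK.induction_on (p := fun K => ∃ M, 0 ≤ M ∧ ∀ y ∈ K, y ∈ O →
      |f y| ≤ M ∧ ‖fderiv ℝ f y‖ ≤ M ∧ ‖fderiv ℝ (fderiv ℝ f) y‖ ≤ M) ⟨0, le_rfl, by simp⟩ ?_ ?_ ?_
  · rintro s t hst ⟨M, hM, h⟩
    exact ⟨M, hM, fun y hy => h y (hst hy)⟩
  · rintro s t ⟨M, hM, h⟩ ⟨N, hN, h'⟩
    refine ⟨max M N, le_max_of_le_left hM, fun y hy hyO => ?_⟩
    rcases hy with hy | hy
    · obtain ⟨h1, h2, h3⟩ := h y hy hyO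
      exact ⟨le_max_of_le_left h1, le_max_of_le_left h2, le_max_of_le_left h3⟩
    · obtain ⟨h1, h2, h3⟩ := h' y hy hyO
      exact ⟨le_max_of_le_right h1, le_max_of_le_right h2, le_max_of_le_right h3⟩
  · intro x hx
    have hxS := hKS hx
    -- Derivatives within `S` need not be unique at its boundary points. A local Taylor series `p`
    -- is therefore bounded by continuity near `x`, and identified with the true derivatives only on
    -- the open part.
    obtain ⟨U, hU, p, hp⟩ := contDiffWithinAt_nat.1 (hf x hxS : ContDiffWithinAt ℝ (2 : ℕ) f S x)
    rw [Set.insert_eq_of_mem hxS] at hU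
    have hbdd : ∀ m : ℕ, m ≤ 2 → ∀ᶠ y in 𝓝[S] x, ‖p y m‖ ≤ ‖p x m‖ + 1 := by
      intro m hm
      have h1 : ContinuousWithinAt (fun y => p y m) U x :=
        hp.cont m (by exact_mod_cast hm) x (mem_of_mem_nhdsWithin hxS hU)
      have h2 := (h1.norm.mono_of_mem_nhdsWithin hU).eventually
        (Iio_mem_nhds (lt_add_one ‖p x m‖))
      exact h2.mono fun y hy => le_of_lt hy
    have hev := ((hbdd 0 (by norm_num)).and ((hbdd 1 (by norm_num)).and
      (hbdd 2 le_rfl))).and (eventually_mem_set.2 hU)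
    obtain ⟨V, hV, hxV, hVS⟩ := mem_nhdsWithin.1 hev
    set N := max (‖p x 0‖ + 1) (max (‖p x 1‖ + 1) (‖p x 2‖ + 1))
    refine ⟨V, mem_nhdsWithin_of_mem_nhds (hV.mem_nhds hxV), N,
      le_max_of_le_left (by positivity), fun y hyV hyO => ?_⟩
    obtain ⟨⟨h0, h1, h2⟩, -⟩ := hVS ⟨hyV, hOS hyO⟩
    have hOV : IsOpen (O ∩ V) := hO.inter hV
    have hp' : HasFTaylorSeriesUpToOn (2 : ℕ) f p (O ∩ V) :=
      hp.mono fun z hz => (hVS ⟨hz.2, hOS hz.1⟩).2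
    have hyOV : y ∈ O ∩ V := ⟨hyO, hyV⟩
    have heq : ∀ m : ℕ, m ≤ 2 → p y m = iteratedFDeriv ℝ m f y := fun m hm => by
      rw [hp'.eq_iteratedFDerivWithin_of_uniqueDiffOn (by exact_mod_cast hm)
        hOV.uniqueDiffOn hyOV, iteratedFDerivWithin_of_isOpen m hOV hyOV]
    rw [heq 0 (by norm_num), norm_iteratedFDeriv_zero] at h0
    rw [heq 1 (by norm_num), norm_iteratedFDeriv_one] at h1
    rw [heq 2 le_rfl, ← norm_iteratedFDeriv_fderiv, norm_iteratedFDeriv_one] at h2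
    exact ⟨le_max_of_le_left h0, le_max_of_le_right (le_max_of_le_left h1),
      le_max_of_le_right (le_max_of_le_right h2)⟩

/-- A subharmonic function vanishing on the boundary is negative. -/
theorem neg_of_laplacian_pos {n : ℕ} {Ω : Set (EuclideanSpace ℝ (Fin n))}
    {u : EuclideanSpace ℝ (Fin n) → ℝ} (hΩ : IsOpen Ω) (hb : Bornology.IsBounded Ω)
    (hu : ContDiffOn ℝ 2 u Ω) (hc : ContinuousOn u (closure Ω))
    (hpos : ∀ x ∈ Ω, 0 < Laplacian.laplacian u x) (h0 : ∀ x ∈ frontier Ω, u x = 0) :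
    ∀ x ∈ Ω, u x < 0 := by
  have hint : ∀ x ∈ Ω, ¬ IsLocalMax u x := by
    intro x hx hmax
    have h1 : ContDiffAt ℝ 2 u x := hu.contDiffAt (hΩ.mem_nhds hx)
    have h2 := hpos x hx
    rw [HessianEq.laplacian_eq_sum u x (EuclideanSpace.basisFun (Fin n) ℝ)] at h2
    refine h2.not_ge (Finset.sum_nonpos fun i _ => ?_)
    set v := EuclideanSpace.basisFun (Fin n) ℝ i
    have hline : ContinuousAt (fun t : ℝ => x + t • v) 0 := by fun_prop
    have hmax' : IsLocalMax (fun t : ℝ => u (x + t • v)) 0 := by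
      have : ∀ᶠ y in 𝓝 (x + (0 : ℝ) • v), u y ≤ u (x + (0 : ℝ) • v) := by simpa using! hmax
      exact hline.eventually this
    have h3 := hmax'.hasDerivAt_eq_zero_and_nonpos
      (eventually_hasDerivAt_line (hu.of_le (by norm_num)) hΩ hx)
      (hasDerivAt_line_zero (hu.dirDeriv hΩ (m := 1) (by norm_num) v) hΩ hx)
    rw [dirDeriv_dirDeriv h1] at h3
    exact h3.2
  intro x hx
  obtain ⟨y, hy, hymax⟩ := hb.isCompact_closure.exists_isMaxOn ⟨x, subset_closure hx⟩ hc
  have hy0 : u y ≤ 0 := by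
    by_cases hyΩ : y ∈ Ω
    · exact absurd ((hymax.on_subset subset_closure).isLocalMax (hΩ.mem_nhds hyΩ)) (hint y hyΩ)
    · exact (h0 y (by rw [hΩ.frontier_eq]; exact ⟨hy, hyΩ⟩)).le
  have hle : ∀ z ∈ Ω, u z ≤ 0 := fun z hz => (hymax (subset_closure hz)).trans hy0
  -- Since u ≤ 0 throughout, an interior zero would be an interior maximum.
  refine (hle x hx).lt_of_ne fun hx0 => hint x hx ?_
  filter_upwards [hΩ.mem_nhds hx] with z hz
  rw [hx0]
  exact hle z hz

/-- Admissible constants for `false_of_critical`. -/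
theorem exists_constants (n : ℕ) {M B R d₀ : ℝ} (hM : 0 ≤ M) (hB : 0 ≤ B) (hR : 0 ≤ R)
    (hd₀ : 0 < d₀) : ∃ a α β K : ℝ, 0 < a ∧ 0 < α ∧ 300 ≤ β ∧
      a * (20 + 9 * B ^ 2) * n < 1 / 800 ∧ a * (28 + 3 * B ^ 2) ≤ 1 ∧
      M + M * n * a * (2 + B) + a * n * B * M + 3 + (M ^ 2 / d₀ + 1000 * M ^ 2 * n) ≤ α ∧
      6 * n * α ^ 2 * R ^ 2 ≤ β ∧ β * B ≤ a * K ∧ α * R ≤ a * K ∧ β * M ≤ K ∧ 1 ≤ K := by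
  -- The order avoids circularity: a depends on n and B, α on a, β on α, and K on all of them.
  set a : ℝ := 1 / (1000 * (n + 1) * (30 + 9 * B ^ 2)) with ha
  have ha0 : 0 < a := by positivity
  set α : ℝ := M + M * n * a * (2 + B) + a * n * B * M + 3 +
    (M ^ 2 / d₀ + 1000 * M ^ 2 * n) with hα
  have hα0 : 0 < α := by positivity
  set β : ℝ := 300 + 6 * n * α ^ 2 * R ^ 2 with hβ
  have hβ0 : 0 < β := by positivity
  refine ⟨a, α, β, (β * B + α * R) / a + β * M + 1, ha0, hα0,
    ?_, ?_, ?_, le_rfl, ?_, ?_, ?_, ?_, ?_⟩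
  · rw [hβ]
    have : 0 ≤ 6 * n * α ^ 2 * R ^ 2 := by positivity
    linarith
  · rw [ha, div_mul_eq_mul_div, div_mul_eq_mul_div, div_lt_div_iff₀ (by positivity) (by norm_num)]
    have : 0 ≤ n * B ^ 2 := by positivity
    have : (0 : ℝ) ≤ n := Nat.cast_nonneg n
    nlinarith [sq_nonneg B]
  · rw [ha, div_mul_eq_mul_div, div_le_one (by positivity)]
    have : 0 ≤ n * B ^ 2 := by positivity
    have : (0 : ℝ) ≤ n := Nat.cast_nonneg n
    nlinarith [sq_nonneg B]
  · rw [hβ]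
    linarith
  all_goals
    have h1 : a * ((β * B + α * R) / a + β * M + 1) = β * B + α * R + a * (β * M + 1) := by
      field_simp
      ring
    have h2 : 0 ≤ a * (β * M + 1) := by positivity
    have h3 : 0 ≤ α * R := by positivity
    have h4 : 0 ≤ β * B := by positivity
    have h5 : 0 ≤ (β * B + α * R) / a := by positivity
    have h6 : 0 ≤ β * M := by positivity
    linarith

/-! ### Iterated derivatives along a frame -/

section frame

variable {E ι : Type*} [NormedAddCommGroup E] [NormedSpace ℝ E]

/-- First derivatives along the frame `b`. -/
noncomputable def frameDeriv₁ (b : ι → E) (u : E → ℝ) (i : ι) : E → ℝ := dirDeriv (b i) u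

/-- Second derivatives along the frame `b`. -/
noncomputable def frameDeriv₂ (b : ι → E) (u : E → ℝ) (i j : ι) : E → ℝ :=
  dirDeriv (b j) (frameDeriv₁ b u i)

/-- Third derivatives along the frame `b`. -/
noncomputable def frameDeriv₃ (b : ι → E) (u : E → ℝ) (i j k : ι) : E → ℝ :=
  dirDeriv (b k) (frameDeriv₂ b u i j)

/-- Fourth derivatives along the frame `b`. -/
noncomputable def frameDeriv₄ (b : ι → E) (u : E → ℝ) (i j k l : ι) : E → ℝ :=
  dirDeriv (b l) (frameDeriv₃ b u i j k)

variable {b : ι → E} {u : E → ℝ} {Ω : Set E}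

theorem contDiffOn_frameDeriv₁ (hu : ContDiffOn ℝ 4 u Ω) (hΩ : IsOpen Ω) (i : ι) :
    ContDiffOn ℝ 3 (frameDeriv₁ b u i) Ω := hu.dirDeriv hΩ (by norm_num) _

theorem contDiffOn_frameDeriv₂ (hu : ContDiffOn ℝ 4 u Ω) (hΩ : IsOpen Ω) (i j : ι) :
    ContDiffOn ℝ 2 (frameDeriv₂ b u i j) Ω :=
  (contDiffOn_frameDeriv₁ hu hΩ i).dirDeriv hΩ (by norm_num) _

theorem contDiffOn_frameDeriv₃ (hu : ContDiffOn ℝ 4 u Ω) (hΩ : IsOpen Ω) (i j k : ι) :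
    ContDiffOn ℝ 1 (frameDeriv₃ b u i j k) Ω :=
  (contDiffOn_frameDeriv₂ hu hΩ i j).dirDeriv hΩ (by norm_num) _

theorem frameDeriv₂_swap (hu : ContDiffOn ℝ 4 u Ω) (hΩ : IsOpen Ω) (i j : ι) :
    Set.EqOn (frameDeriv₂ b u i j) (frameDeriv₂ b u j i) Ω :=
  dirDeriv_comm (hu.of_le (by norm_num)) hΩ _ _

theorem frameDeriv₃_swap₁ (hu : ContDiffOn ℝ 4 u Ω) (hΩ : IsOpen Ω) (i j k : ι) :
    Set.EqOn (frameDeriv₃ b u i j k) (frameDeriv₃ b u j i k) Ω :=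
  (frameDeriv₂_swap hu hΩ i j).dirDeriv hΩ _

theorem frameDeriv₃_swap₂ (hu : ContDiffOn ℝ 4 u Ω) (hΩ : IsOpen Ω) (i j k : ι) :
    Set.EqOn (frameDeriv₃ b u i j k) (frameDeriv₃ b u i k j) Ω :=
  dirDeriv_comm ((contDiffOn_frameDeriv₁ hu hΩ i).of_le (by norm_num)) hΩ _ _

/-- Adjacent derivatives are exchanged one pair at a time, each exchange within the available C⁴
regularity. It turns the terms l_i u_iikk of the twice differentiated equation, summed over k, into
l_i ∂_i∂_iΔu. -/
theorem frameDeriv₄_swap (hu : ContDiffOn ℝ 4 u Ω) (hΩ : IsOpen Ω) (i k : ι) :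
    Set.EqOn (frameDeriv₄ b u i i k k) (frameDeriv₄ b u k k i i) Ω := by
  have h1 : Set.EqOn (frameDeriv₄ b u i i k k) (frameDeriv₄ b u i k i k) Ω :=
    (frameDeriv₃_swap₂ hu hΩ i i k).dirDeriv hΩ _
  have h2 : Set.EqOn (frameDeriv₄ b u i k i k) (frameDeriv₄ b u k i i k) Ω :=
    (frameDeriv₃_swap₁ hu hΩ i k i).dirDeriv hΩ _
  have h3 : Set.EqOn (frameDeriv₄ b u k i i k) (frameDeriv₄ b u k i k i) Ω :=
    dirDeriv_comm ((contDiffOn_frameDeriv₂ hu hΩ k i).of_le (by norm_num)) hΩ _ _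
  have h4 : Set.EqOn (frameDeriv₄ b u k i k i) (frameDeriv₄ b u k k i i) Ω :=
    (frameDeriv₃_swap₂ hu hΩ k i k).dirDeriv hΩ _
  exact ((h1.trans h2).trans h3).trans h4

theorem frameDeriv₂_eq (hu : ContDiffOn ℝ 4 u Ω) (hΩ : IsOpen Ω) (i j : ι) {x : E} (hx : x ∈ Ω) :
    frameDeriv₂ b u i j x = fderiv ℝ (fderiv ℝ u) x (b j) (b i) :=
  dirDeriv_dirDeriv ((hu.contDiffAt (hΩ.mem_nhds hx)).of_le (by norm_num)) _ _

end frame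

/-! ### The equation and the test function in an orthonormal frame -/

section orthonormal

variable {n : ℕ} {b : OrthonormalBasis (Fin n) ℝ (EuclideanSpace ℝ (Fin n))}
  {u : EuclideanSpace ℝ (Fin n) → ℝ} {Ω : Set (EuclideanSpace ℝ (Fin n))}
  {x : EuclideanSpace ℝ (Fin n)}

theorem sum_frameDeriv₁_smul (x : EuclideanSpace ℝ (Fin n)) :
    ∑ i, frameDeriv₁ b u i x • b i = ∇ u x := by
  rw [← b.sum_repr' (∇ u x)]
  refine Finset.sum_congr rfl fun i _ => ?_
  rw [real_inner_comm, inner_gradient_left]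
  rfl

theorem sum_frameDeriv₁_sq (x : EuclideanSpace ℝ (Fin n)) :
    ∑ i, frameDeriv₁ b u i x ^ 2 = ‖∇ u x‖ ^ 2 := by
  rw [← b.sum_sq_inner_left]
  refine Finset.sum_congr rfl fun i _ => ?_
  rw [inner_gradient_left]
  rfl

theorem sum_frameDeriv₂ (hu : ContDiffOn ℝ 4 u Ω) (hΩ : IsOpen Ω) (hx : x ∈ Ω) :
    ∑ i, frameDeriv₂ b u i i x = Laplacian.laplacian u x := by
  rw [HessianEq.laplacian_eq_sum u x b]
  exact Finset.sum_congr rfl fun i _ => frameDeriv₂_eq hu hΩ i i hx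

theorem sum_frameDeriv₂_sq (hu : ContDiffOn ℝ 4 u Ω) (hΩ : IsOpen Ω) (hx : x ∈ Ω) :
    (∑ i, frameDeriv₂ b u i i x) ^ 2 - ∑ i, ∑ j, frameDeriv₂ b u i j x ^ 2 =
      2 * HessianEq.sigma 2 (HessianEq.hessianEigenvalues u x) := by
  rw [HessianEq.two_mul_sigma_two_hessian
    ((hu.contDiffAt (hΩ.mem_nhds hx)).of_le (by norm_num)) b, sum_frameDeriv₂ hu hΩ hx,
    Finset.sum_comm]
  simp only [frameDeriv₂_eq hu hΩ _ _ hx]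

/-- The equation `σ₂(D²u) = f(x, u, ∇u)` differentiated once and twice in a frame direction. -/
theorem frame_derivatives_of_equation
    {f : EuclideanSpace ℝ (Fin n) × ℝ × EuclideanSpace ℝ (Fin n) → ℝ}
    (hu : ContDiffOn ℝ 4 u Ω) (hΩ : IsOpen Ω) (hx : x ∈ Ω)
    (hf : ContDiffAt ℝ 2 f (x, u x, ∇ u x))
    (heq : ∀ x ∈ Ω, HessianEq.sigma 2 (HessianEq.hessianEigenvalues u x) = f (x, u x, ∇ u x))
    (k : Fin n) {Y : EuclideanSpace ℝ (Fin n) × ℝ × EuclideanSpace ℝ (Fin n)}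
    (hY : Y = (b k, frameDeriv₁ b u k x, ∑ i, frameDeriv₂ b u i k x • b i)) :
    (∑ i, frameDeriv₂ b u i i x) * (∑ i, frameDeriv₃ b u i i k x)
      - ∑ i, ∑ j, frameDeriv₂ b u i j x * frameDeriv₃ b u i j k x =
      fderiv ℝ f (x, u x, ∇ u x) Y ∧
    (∑ i, frameDeriv₃ b u i i k x) ^ 2
      + (∑ i, frameDeriv₂ b u i i x) * (∑ i, frameDeriv₄ b u i i k k x)
      - ∑ i, ∑ j, (frameDeriv₃ b u i j k x ^ 2
        + frameDeriv₂ b u i j x * frameDeriv₄ b u i j k k x) =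
      fderiv ℝ (fderiv ℝ f) (x, u x, ∇ u x) Y Y +
        fderiv ℝ f (x, u x, ∇ u x) (0, frameDeriv₂ b u k k x, ∑ i, frameDeriv₃ b u i k k x • b i) := by
  subst hY
  have h1 : ContDiffOn ℝ 1 u Ω := hu.of_le (by norm_num)
  have h2 : ∀ i, ContDiffOn ℝ 1 (frameDeriv₁ b u i) Ω := fun i =>
    (contDiffOn_frameDeriv₁ hu hΩ i).of_le (by norm_num)
  have h3 : ∀ i j, ContDiffOn ℝ 1 (frameDeriv₂ b u i j) Ω := fun i j =>
    (contDiffOn_frameDeriv₂ hu hΩ i j).of_le (by norm_num)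
  have h4 : ∀ i j k, ContDiffOn ℝ 1 (frameDeriv₃ b u i j k) Ω := fun i j k =>
    contDiffOn_frameDeriv₃ hu hΩ i j k
  have hline := eventually_line_mem (v := b k) hΩ hx
  have hid : ∀ t : ℝ, HasDerivAt (fun t : ℝ => x + t • b k) (b k) t := fun t => by
    simpa using ((hasDerivAt_id' t).smul_const (b k)).const_add x
  -- The curve is the 1-jet (x, u, ∇u) of u along the line; `Y` is its velocity at 0, so the
  -- right-hand side is f composed with a curve.
  have hγ : ∀ᶠ t in 𝓝 (0 : ℝ), HasDerivAt
      (fun t : ℝ => (x + t • b k, u (x + t • b k), ∑ i, frameDeriv₁ b u i (x + t • b k) • b i))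
      (b k, frameDeriv₁ b u k (x + t • b k), ∑ i, frameDeriv₂ b u i k (x + t • b k) • b i) t := by
    filter_upwards [hline] with t ht
    exact (hid t).prodMk ((hasDerivAt_line h1 hΩ ht).prodMk
      (HasDerivAt.fun_sum fun i _ => (hasDerivAt_line (h2 i) hΩ ht).smul_const _))
  have hγ₁ : HasDerivAt
      (fun t : ℝ => (b k, frameDeriv₁ b u k (x + t • b k),
        ∑ i, frameDeriv₂ b u i k (x + t • b k) • b i))
      (0, frameDeriv₂ b u k k x, ∑ i, frameDeriv₃ b u i k k x • b i) 0 :=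
    (hasDerivAt_const (0 : ℝ) (b k)).prodMk ((hasDerivAt_line_zero (h2 k) hΩ hx).prodMk
      (HasDerivAt.fun_sum fun i _ => (hasDerivAt_line_zero (h3 i k) hΩ hx).smul_const _))
  have hf' : ContDiffAt ℝ 2 f ((fun t : ℝ => (x + t • b k, u (x + t • b k),
      ∑ i, frameDeriv₁ b u i (x + t • b k) • b i)) 0) := by
    simpa [sum_frameDeriv₁_smul] using hf
  obtain ⟨hG, hG₁⟩ := hasDerivAt_comp_curve_twice hf' hγ hγ₁
  have key := derivatives_of_equation
    (S := fun t => ∑ i, frameDeriv₂ b u i i (x + t • b k))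
    (S₁ := fun t => ∑ i, frameDeriv₃ b u i i k (x + t • b k))
    (U := fun i j t => frameDeriv₂ b u i j (x + t • b k))
    (U₁ := fun i j t => frameDeriv₃ b u i j k (x + t • b k))
    (U₂ := fun i j => frameDeriv₄ b u i j k k x)
    (S₂ := ∑ i, frameDeriv₄ b u i i k k x)
    (hline.mono fun t ht => HasDerivAt.fun_sum fun i _ => hasDerivAt_line (h3 i i) hΩ ht)
    (HasDerivAt.fun_sum fun i _ => hasDerivAt_line_zero (h4 i i k) hΩ hx) hG hG₁
    (fun i j => eventually_hasDerivAt_line (h3 i j) hΩ hx)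
    (fun i j => hasDerivAt_line_zero (h4 i j k) hΩ hx)
    (hline.mono fun t ht => by
      rw [sum_frameDeriv₂_sq hu hΩ ht, heq _ ht, sum_frameDeriv₁_smul])
  simpa only [zero_smul, add_zero, sum_frameDeriv₁_smul] using key

/-- The first and second order conditions at a local maximum of the test function. -/
theorem frame_test_function_conditions {a α β ε : ℝ}
    (hu : ContDiffOn ℝ 4 u Ω) (hΩ : IsOpen Ω) (hx : x ∈ Ω)
    (hS : 0 < Laplacian.laplacian u x) (hW : 0 < -u x - ε)
    (hmax : IsLocalMax (fun y => Real.log (Laplacian.laplacian u y) + β * Real.log (-u y - ε)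
      + a / 2 * ‖∇ u y‖ ^ 2 + α / 2 * ‖y‖ ^ 2) x) (k : Fin n) :
    (∑ i, frameDeriv₃ b u i i k x) / Laplacian.laplacian u x
      + β * (-frameDeriv₁ b u k x / (-u x - ε))
      + a * ∑ j, frameDeriv₁ b u j x * frameDeriv₂ b u j k x + α * ⟪x, b k⟫_ℝ = 0 ∧
    (∑ i, frameDeriv₄ b u i i k k x) / Laplacian.laplacian u x
      - ((∑ i, frameDeriv₃ b u i i k x) / Laplacian.laplacian u x) ^ 2
      + β * (-frameDeriv₂ b u k k x / (-u x - ε) - (-frameDeriv₁ b u k x / (-u x - ε)) ^ 2)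
      + a * ∑ j, (frameDeriv₂ b u j k x ^ 2 + frameDeriv₁ b u j x * frameDeriv₃ b u j k k x)
      + α ≤ 0 := by
  have h1 : ContDiffOn ℝ 1 u Ω := hu.of_le (by norm_num)
  have h2 : ∀ i, ContDiffOn ℝ 1 (frameDeriv₁ b u i) Ω := fun i =>
    (contDiffOn_frameDeriv₁ hu hΩ i).of_le (by norm_num)
  have h3 : ∀ i j, ContDiffOn ℝ 1 (frameDeriv₂ b u i j) Ω := fun i j =>
    (contDiffOn_frameDeriv₂ hu hΩ i j).of_le (by norm_num)
  have h4 : ∀ i j k, ContDiffOn ℝ 1 (frameDeriv₃ b u i j k) Ω := fun i j k =>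
    contDiffOn_frameDeriv₃ hu hΩ i j k
  have hline := eventually_line_mem (v := b k) hΩ hx
  have key := test_function_conditions (x := x) (v := b k) (a := a) (α := α) (β := β)
    (S := fun t => ∑ i, frameDeriv₂ b u i i (x + t • b k))
    (S₁ := fun t => ∑ i, frameDeriv₃ b u i i k (x + t • b k))
    (W := fun t => -u (x + t • b k) - ε)
    (W₁ := fun t => -frameDeriv₁ b u k (x + t • b k))
    (P := fun j t => frameDeriv₁ b u j (x + t • b k))
    (P₁ := fun j t => frameDeriv₂ b u j k (x + t • b k))
    (P₂ := fun j => frameDeriv₃ b u j k k x)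
    (S₂ := ∑ i, frameDeriv₄ b u i i k k x) (W₂ := -frameDeriv₂ b u k k x)
    (b.norm_eq_one k)
    (hline.mono fun t ht => HasDerivAt.fun_sum fun i _ => hasDerivAt_line (h3 i i) hΩ ht)
    (HasDerivAt.fun_sum fun i _ => hasDerivAt_line_zero (h4 i i k) hΩ hx)
    (by simpa [sum_frameDeriv₂ hu hΩ hx] using hS)
    (hline.mono fun t ht => (hasDerivAt_line h1 hΩ ht).fun_neg.sub_const ε)
    (hasDerivAt_line_zero (h2 k) hΩ hx).fun_neg (by simpa using hW)
    (fun j => eventually_hasDerivAt_line (h2 j) hΩ hx)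
    (fun j => hasDerivAt_line_zero (h3 j k) hΩ hx) ?_
  · simpa only [zero_smul, add_zero, sum_frameDeriv₂ hu hΩ hx] using key
  · have hc : ContinuousAt (fun t : ℝ => x + t • b k) 0 := by fun_prop
    have h5 : ∀ᶠ y in 𝓝 (x + (0 : ℝ) • b k), Real.log (Laplacian.laplacian u y)
        + β * Real.log (-u y - ε) + a / 2 * ‖∇ u y‖ ^ 2 + α / 2 * ‖y‖ ^ 2 ≤
        Real.log (Laplacian.laplacian u x) + β * Real.log (-u x - ε)
        + a / 2 * ‖∇ u x‖ ^ 2 + α / 2 * ‖x‖ ^ 2 := by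
      rw [zero_smul, add_zero]
      exact hmax
    filter_upwards [hc.eventually h5, hline] with t h6 ht
    simp only [zero_smul, add_zero, sum_frameDeriv₂ hu hΩ hx, sum_frameDeriv₂ hu hΩ ht,
      sum_frameDeriv₁_sq]
    exact h6

end orthonormal

/-! ### Contradiction at a critical point of the test function -/

namespace HessianEq

variable {n : ℕ} {u : EuclideanSpace ℝ (Fin n) → ℝ} {Ω : Set (EuclideanSpace ℝ (Fin n))}
  {f : EuclideanSpace ℝ (Fin n) × ℝ × EuclideanSpace ℝ (Fin n) → ℝ}

theorem IsSolution.laplacian_pos (hsol : IsSolution 2 Ω f u) (hΩ : IsOpen Ω)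
    {x : EuclideanSpace ℝ (Fin n)} (hx : x ∈ Ω) : 0 < Laplacian.laplacian u x := by
  have h := hsol.kConvex.2 x hx 1 le_rfl one_le_two
  rwa [sigma_one, sum_hessianEigenvalues
    ((hsol.contDiffOn.contDiffAt (hΩ.mem_nhds hx)).of_le (by norm_num))] at h

/-- In dimension below two σ₂ is an empty sum, so it cannot be positive. -/
theorem IsSolution.two_le (hsol : IsSolution 2 Ω f u) {x : EuclideanSpace ℝ (Fin n)}
    (hx : x ∈ Ω) : 2 ≤ n := by
  have h := hsol.kConvex.2 x hx 2 one_le_two le_rfl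
  by_contra! hn
  rw [sigma, Finset.powersetCard_eq_empty.2 (by simpa using hn), Finset.sum_empty] at h
  exact lt_irrefl _ h

/-- A lower bound for the sum of the second derivatives of the right-hand side. -/
theorem neg_le_sum_second_derivatives
    {b : OrthonormalBasis (Fin n) ℝ (EuclideanSpace ℝ (Fin n))}
    {y : EuclideanSpace ℝ (Fin n) × ℝ × EuclideanSpace ℝ (Fin n)}
    {Y : Fin n → EuclideanSpace ℝ (Fin n) × ℝ × EuclideanSpace ℝ (Fin n)}
    {l σ : Fin n → ℝ} {T : Fin n → Fin n → ℝ} {s M₀ M c : ℝ} (hs1 : 1 ≤ s)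
    (hl : ∑ i, l i = s) (hσ : ∀ i, ∑ k, T i k = σ i) (hM₀ : 0 ≤ M₀) (hf₁ : ‖fderiv ℝ f y‖ ≤ M₀)
    (hf₂ : ‖fderiv ℝ (fderiv ℝ f) y‖ ≤ M₀) (hY : ∀ k, ‖Y k‖ ≤ c * s)
    (hM : M₀ * (n * c ^ 2 + 1) ≤ M) :
    -(M * s ^ 2) - M * ∑ k, |σ k| ≤
      ∑ k, (fderiv ℝ (fderiv ℝ f) y (Y k) (Y k) + fderiv ℝ f y (0, l k, ∑ i, T i k • b i)) := by
  have hs0 : 0 < s := by linarith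
  have hσ0 : 0 ≤ ∑ k, |σ k| := Finset.sum_nonneg fun _ _ => abs_nonneg _
  rw [Finset.sum_add_distrib, ← map_sum]
  -- Summing over k before estimating turns the third derivatives of u into the gradient of Δu, the
  -- only third order quantity controlled by the first order condition.
  have h1 : ∑ k, ((0 : EuclideanSpace ℝ (Fin n)), l k, ∑ i, T i k • b i) =
      (0, s, ∑ i, σ i • b i) := by
    refine Prod.ext ?_ (Prod.ext ?_ ?_) <;>
      simp only [Prod.fst_sum, Prod.snd_sum, Finset.sum_const_zero, hl]
    rw [Finset.sum_comm]
    exact Finset.sum_congr rfl fun i _ => by rw [← Finset.sum_smul, hσ]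
  have h2 : ‖((0 : EuclideanSpace ℝ (Fin n)), s, ∑ i, σ i • b i)‖ ≤ s + ∑ k, |σ k| := by
    have h3 : ‖∑ i, σ i • b i‖ ≤ ∑ k, |σ k| := by
      refine (norm_sum_le _ _).trans_eq ?_
      simp [norm_smul]
    simp only [Prod.norm_mk, norm_zero, Real.norm_eq_abs, abs_of_pos hs0]
    exact max_le (by linarith) (max_le (by linarith) (by linarith))
  have h3 : |fderiv ℝ f y (0, s, ∑ i, σ i • b i)| ≤ M₀ * (s + ∑ k, |σ k|) := by
    rw [← Real.norm_eq_abs]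
    exact (ContinuousLinearMap.le_opNorm _ _).trans (by gcongr)
  have h4 : ∑ k : Fin n, -(M₀ * (c * s) ^ 2) ≤ ∑ k, fderiv ℝ (fderiv ℝ f) y (Y k) (Y k) := by
    refine Finset.sum_le_sum fun k _ => neg_le_of_abs_le ?_
    have hk := hY k
    have hk0 : 0 ≤ c * s := (norm_nonneg _).trans hk
    calc |fderiv ℝ (fderiv ℝ f) y (Y k) (Y k)|
        ≤ ‖fderiv ℝ (fderiv ℝ f) y‖ * ‖Y k‖ * ‖Y k‖ := by
          rw [← Real.norm_eq_abs]
          exact ContinuousLinearMap.le_opNorm₂ _ _ _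
      _ ≤ M₀ * (c * s) * (c * s) := by gcongr
      _ = _ := by ring
  rw [Finset.sum_const, Finset.card_univ, Fintype.card_fin, nsmul_eq_mul] at h4
  rw [h1]
  have h5 := neg_le_of_abs_le h3
  have h6 := mul_le_mul_of_nonneg_right hM (sq_nonneg s)
  have hM₀M : M₀ ≤ M := by
    refine le_trans ?_ hM
    have : 0 ≤ n * c ^ 2 := by positivity
    exact le_mul_of_one_le_right hM₀ (by linarith)
  have h7 := mul_le_mul_of_nonneg_right hM₀M hσ0
  have h8 : M₀ * s ≤ M₀ * s ^ 2 :=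
    mul_le_mul_of_nonneg_left (le_self_pow₀ hs1 two_ne_zero) hM₀
  linarith

/-- For admissible constants, `Δu` and `w Δu` cannot both be large at a local maximum of the test
function `log Δu + β log w + a/2 |∇u|² + α/2 |x|²` with `w = -u - ε`. -/
theorem IsSolution.false_of_isLocalMax (hsol : IsSolution 2 Ω f u) (hΩ : IsOpen Ω)
    {x : EuclideanSpace ℝ (Fin n)} (hx : x ∈ Ω)
    {M₀ M B R c₀ a α β K ε : ℝ} (hB : 0 ≤ B) (hR : 0 ≤ R) (hc₀ : 0 < c₀) (hM₀ : 0 ≤ M₀)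
    (hfx : ContDiffAt ℝ 2 f (x, u x, ∇ u x)) (hf₀ : |f (x, u x, ∇ u x)| ≤ M₀)
    (hf₁ : ‖fderiv ℝ f (x, u x, ∇ u x)‖ ≤ M₀)
    (hf₂ : ‖fderiv ℝ (fderiv ℝ f) (x, u x, ∇ u x)‖ ≤ M₀)
    (hfc : c₀ ≤ f (x, u x, ∇ u x)) (hgrad : ‖∇ u x‖ ≤ B) (hxR : ‖x‖ ≤ R)
    (hM : M = M₀ * (n * (1 + B) ^ 2 + B + 4))
    (ha : 0 < a) (hβ : 300 ≤ β) (ha₁ : a * (20 + 9 * B ^ 2) * n < 1 / 800)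
    (ha₂ : a * (28 + 3 * B ^ 2) ≤ 1)
    (hα : M + M * n * a * (2 + B) + a * n * B * M + 3 +
      (M ^ 2 / (2 * c₀) + 1000 * M ^ 2 * n) ≤ α)
    (hβα : 6 * n * α ^ 2 * R ^ 2 ≤ β)
    (hK₁ : β * B ≤ a * K) (hK₂ : α * R ≤ a * K) (hK₃ : β * M ≤ K) (hK₄ : 1 ≤ K)
    (hW : 0 < -u x - ε)
    (hmax : IsLocalMax (fun y => Real.log (Laplacian.laplacian u y) + β * Real.log (-u y - ε)
      + a / 2 * ‖∇ u y‖ ^ 2 + α / 2 * ‖y‖ ^ 2) x)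
    (hsK : K ≤ Laplacian.laplacian u x)
    (hswK : K ≤ Laplacian.laplacian u x * (-u x - ε)) : False := by
  have hu := hsol.contDiffOn
  have hu2 : ContDiffAt ℝ 2 u x := (hu.contDiffAt (hΩ.mem_nhds hx)).of_le (by norm_num)
  -- The frame diagonalizes the Hessian at `x` only and is kept constant, so derivatives along it
  -- commute on all of Ω.
  obtain ⟨b, hb⟩ := exists_orthonormalBasis_hessian hu2
  set l := hessianEigenvalues u x
  set s := Laplacian.laplacian u x with hs
  have hs1 : 1 ≤ s := hK₄.trans hsK
  have hs0 : 0 < s := by linarith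
  have hl : ∑ i, l i = s := sum_hessianEigenvalues hu2
  have hdiag : ∀ i j, frameDeriv₂ b u i j x = if i = j then l i else 0 := fun i j => by
    rw [frameDeriv₂_eq hu hΩ i j hx, hb]
    by_cases hij : i = j
    · simp [hij]
    · simp [hij, Ne.symm hij]
  have hd : s ^ 2 - ∑ i, l i ^ 2 = 2 * f (x, u x, ∇ u x) := by
    rw [← hsol.equation x hx, two_mul_sigma_two, hl]
  have hls2 : ∑ i, l i ^ 2 ≤ s ^ 2 := by linarith
  have hli : ∀ i, |l i| ≤ s := fun i => abs_le_of_sq_le_sq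
    ((Finset.single_le_sum (f := fun i => l i ^ 2) (fun _ _ => sq_nonneg _)
      (Finset.mem_univ i)).trans hls2) hs0.le
  have hpsum : ∑ i, frameDeriv₁ b u i x ^ 2 ≤ B ^ 2 := by
    rw [sum_frameDeriv₁_sq]
    gcongr
  have hpi : ∀ i, |frameDeriv₁ b u i x| ≤ B := fun i => abs_le_of_sq_le_sq
    ((Finset.single_le_sum (f := fun i => frameDeriv₁ b u i x ^ 2) (fun _ _ => sq_nonneg _)
      (Finset.mem_univ i)).trans hpsum) hB
  set Y : Fin n → EuclideanSpace ℝ (Fin n) × ℝ × EuclideanSpace ℝ (Fin n) := fun k =>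
    (b k, frameDeriv₁ b u k x, ∑ i, frameDeriv₂ b u i k x • b i) with hY
  have hBs : s ≤ (1 + B) * s := le_mul_of_one_le_left hs0.le (by linarith)
  have hYn : ∀ k, ‖Y k‖ ≤ (1 + B) * s := by
    intro k
    have h1 : ∑ i, frameDeriv₂ b u i k x • b i = l k • b k := by simp [hdiag]
    simp only [hY, h1, Prod.norm_mk, norm_smul, b.norm_eq_one, mul_one, Real.norm_eq_abs]
    refine max_le (hs1.trans hBs) (max_le ((hpi k).trans ?_) ((hli k).trans hBs))
    nlinarith
  have hcond := fun k => frame_derivatives_of_equation hu hΩ hx hfx hsol.equation k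
    (Y := Y k) rfl
  rw [sum_frameDeriv₂ hu hΩ hx] at hcond
  simp only [hdiag, ite_mul, zero_mul, Finset.sum_add_distrib, Finset.sum_ite_eq,
    Finset.mem_univ, if_true, ← hs] at hcond
  set y := (x, u x, ∇ u x)
  have htest := fun k => frame_test_function_conditions (b := b) hu hΩ hx hs0 hW hmax k
  simp only [hdiag, mul_ite, mul_zero, ite_pow, Finset.sum_add_distrib, Finset.sum_ite_eq',
    Finset.mem_univ, if_true, ← hs] at htest
  -- The factor in M covers three uses: 2 for d = 2f, 1 + B for g, and n(1 + B)² + 1 for the second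
  -- derivatives of f.
  have hM₀M : ∀ c, c ≤ n * (1 + B) ^ 2 + B + 4 → M₀ * c ≤ M := fun c hc => by
    rw [hM]; gcongr
  have hnB : 0 ≤ n * (1 + B) ^ 2 := by positivity
  have hM0 : 0 ≤ M := by rw [hM]; positivity
  have hlap := neg_le_sum_second_derivatives (b := b) (y := y) (Y := Y) (l := l)
    (T := fun i k => frameDeriv₃ b u i k k x) (σ := fun i => ∑ k, frameDeriv₃ b u k k i x) hs1 hl
    (fun i => Finset.sum_congr rfl fun k _ => by
      rw [frameDeriv₃_swap₁ hu hΩ i k k hx, frameDeriv₃_swap₂ hu hΩ k i k hx])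
    hM₀ hf₁ hf₂ hYn (hM₀M (n * (1 + B) ^ 2 + 1) (by linarith))
  refine false_of_critical (ι := Fin n) (l := l) (p := fun i => frameDeriv₁ b u i x)
    (ξ := fun i => ⟪x, b i⟫_ℝ) (q := fun k => ∑ i, frameDeriv₄ b u i i k k x)
    (g := fun k => fderiv ℝ f y (Y k)) (T := fun i j k => frameDeriv₃ b u i j k x)
    (s := s) (w := -u x - ε) (d := 2 * f y) (d₀ := 2 * c₀)
    (dG := ∑ k, (fderiv ℝ (fderiv ℝ f) y (Y k) (Y k) +
        fderiv ℝ f y (0, l k, ∑ i, frameDeriv₃ b u i k k x • b i)))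
    (a := a) (α := α) (β := β) (K := K) (M := M) (B := B) (R := R)
    (by simpa using hsol.two_le hx) (fun i j k => frameDeriv₃_swap₁ hu hΩ i j k hx)
    (fun i j k => frameDeriv₃_swap₂ hu hΩ i j k hx) hl hd (by linarith) (by linarith) ?_ hM0
    hB hR hpsum ?_ hW ha hβ (by simpa using ha₁) ha₂ (by simpa using hα) (by simpa using hβα)
    hK₁ hK₂ hK₃ hK₄ hsK hswK ?_ ?_ ?_ hlap ?_ ?_
  · have := hM₀M 2 (by linarith)
    linarith [le_of_abs_le hf₀]
  · rw [b.sum_sq_inner_left]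
    gcongr
  · intro k
    rw [← (hcond k).1]
    simp only [sub_mul, Finset.sum_sub_distrib, Finset.mul_sum]
  · intro k
    have h1 : |fderiv ℝ f y (Y k)| ≤ M₀ * ((1 + B) * s) := by
      rw [← Real.norm_eq_abs]
      refine (ContinuousLinearMap.le_opNorm _ _).trans ?_
      have := hYn k
      gcongr
    have h2 := mul_le_mul_of_nonneg_right (hM₀M (1 + B) (by linarith)) hs0.le
    linarith
  · have h1 : ∀ k, fderiv ℝ (fderiv ℝ f) y (Y k) (Y k) +
        fderiv ℝ f y (0, l k, ∑ i, frameDeriv₃ b u i k k x • b i) = _ :=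
      fun k => (hcond k).2.symm
    simp only [h1]
    have h2 : ∑ k, ∑ i, l i * frameDeriv₄ b u i i k k x =
        ∑ k, l k * ∑ i, frameDeriv₄ b u i i k k x := by
      rw [Finset.sum_comm]
      refine Finset.sum_congr rfl fun k _ => ?_
      rw [Finset.mul_sum]
      exact Finset.sum_congr rfl fun i _ => by rw [frameDeriv₄_swap hu hΩ k i hx]
    simp only [Finset.sum_sub_distrib, Finset.sum_add_distrib, sub_mul, h2]
    ring
  · intro k
    have h1 := (htest k).1
    have h2 : -frameDeriv₁ b u k x / (-u x - ε) = -(frameDeriv₁ b u k x / (-u x - ε)) :=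
      neg_div _ _
    rw [h2] at h1
    linarith
  · intro k
    have h1 := (htest k).2
    rw [neg_div, neg_div, neg_sq] at h1
    simpa using h1

end HessianEq

/-! ### From the critical point to the bound -/

namespace HessianEq

variable {n : ℕ} {u : EuclideanSpace ℝ (Fin n) → ℝ} {Ω : Set (EuclideanSpace ℝ (Fin n))}

theorem continuousOn_laplacian (hu : ContDiffOn ℝ 4 u Ω) (hΩ : IsOpen Ω) :
    ContinuousOn (Laplacian.laplacian u) Ω := by
  set b := EuclideanSpace.basisFun (Fin n) ℝ
  have h : ContinuousOn (fun x => ∑ i, frameDeriv₂ b u i i x) Ω :=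
    continuousOn_finsetSum _ fun i _ => (contDiffOn_frameDeriv₂ hu hΩ i i).continuousOn
  exact h.congr fun x hx => (sum_frameDeriv₂ hu hΩ hx).symm

theorem continuousOn_norm_gradient_sq (hu : ContDiffOn ℝ 4 u Ω) (hΩ : IsOpen Ω) :
    ContinuousOn (fun x => ‖∇ u x‖ ^ 2) Ω := by
  set b := EuclideanSpace.basisFun (Fin n) ℝ
  have h : ContinuousOn (fun x => ∑ i, frameDeriv₁ b u i x ^ 2) Ω :=
    continuousOn_finsetSum _ fun i _ => (contDiffOn_frameDeriv₁ hu hΩ i).continuousOn.pow 2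
  exact h.congr fun x _ => (sum_frameDeriv₁_sq x).symm

/-- If at every local maximum of the logarithmic test function one of `s`, `s w` is smaller than
`K`, then `w ^ β s` is bounded, where `s = Δu` and `w = -u - ε`. -/
theorem rpow_mul_laplacian_le {A B R K a α β ε : ℝ} (hΩ : IsOpen Ω)
    (hb : Bornology.IsBounded Ω) (hu : ContDiffOn ℝ 4 u Ω) (hc : ContinuousOn u (closure Ω))
    (hpos : ∀ x ∈ Ω, 0 < Laplacian.laplacian u x) (h0 : ∀ x ∈ frontier Ω, u x = 0)
    (ha : 0 ≤ a) (hα : 0 ≤ α) (hβ : 1 ≤ β) (hε : 0 < ε) (hK : 0 ≤ K)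
    (hA : ∀ x ∈ Ω, -u x ≤ A) (hA1 : 1 ≤ A) (hB : ∀ x ∈ Ω, ‖∇ u x‖ ≤ B)
    (hR : ∀ x ∈ Ω, ‖x‖ ≤ R)
    (hcrit : ∀ x ∈ Ω, 0 < -u x - ε →
      IsLocalMax (fun y => Real.log (Laplacian.laplacian u y) + β * Real.log (-u y - ε)
        + a / 2 * ‖∇ u y‖ ^ 2 + α / 2 * ‖y‖ ^ 2) x →
      K ≤ Laplacian.laplacian u x → ¬ K ≤ Laplacian.laplacian u x * (-u x - ε))
    {x : EuclideanSpace ℝ (Fin n)} (hx : x ∈ Ω) (hxε : 0 < -u x - ε) :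
    (-u x - ε) ^ β * Laplacian.laplacian u x ≤
      A ^ β * K * Real.exp (a / 2 * B ^ 2 + α / 2 * R ^ 2) := by
  have hβ0 : 0 < β := by linarith
  -- The shift by ε keeps the maximization on a compact subset of Ω, since u is only continuous up
  -- to the boundary.
  set S := closure Ω ∩ u ⁻¹' Set.Iic (-ε) with hS
  have hSc : IsCompact S := hb.isCompact_closure.of_isClosed_subset
    (hc.preimage_isClosed_of_isClosed isClosed_closure isClosed_Iic) Set.inter_subset_left
  have hSΩ : S ⊆ Ω := by
    rintro y ⟨hy, hyε⟩
    by_contra hyΩ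
    have := h0 y (by rw [hΩ.frontier_eq]; exact ⟨hy, hyΩ⟩)
    rw [Set.mem_preimage, this, Set.mem_Iic] at hyε
    linarith
  -- The exponential of the test function is maximized because it is continuous on all of `S` and
  -- vanishes where u = -ε; its maximum therefore lies where w > 0 and the logarithm is smooth.
  set ψ : EuclideanSpace ℝ (Fin n) → ℝ := fun y => (-u y - ε) ^ β * Laplacian.laplacian u y *
    Real.exp (a / 2 * ‖∇ u y‖ ^ 2 + α / 2 * ‖y‖ ^ 2) with hψ
  have hψc : ContinuousOn ψ Ω := by
    refine ((((hu.continuousOn.neg.sub continuousOn_const).rpow_const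
      fun _ _ => Or.inr hβ0.le)).mul (continuousOn_laplacian hu hΩ)).mul
      (Real.continuous_exp.comp_continuousOn ((continuousOn_const.mul
        (continuousOn_norm_gradient_sq hu hΩ)).add (by fun_prop)))
  have hxS : x ∈ S := ⟨subset_closure hx, by simp only [Set.mem_preimage, Set.mem_Iic]; linarith⟩
  obtain ⟨z, hz, hzmax⟩ := hSc.exists_isMaxOn ⟨x, hxS⟩ (hψc.mono hSΩ)
  have hzΩ := hSΩ hz
  have hψx : 0 < ψ x := mul_pos (mul_pos (Real.rpow_pos_of_pos hxε _) (hpos x hx)) (Real.exp_pos _)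
  have hψz : 0 < ψ z := hψx.trans_le (hzmax hxS)
  have hzε : 0 < -u z - ε := by
    have h1 : u z ≤ -ε := hz.2
    rcases (show 0 ≤ -u z - ε by linarith).eq_or_lt with h2 | h2
    · simp only [hψ, ← h2, Real.zero_rpow hβ0.ne', zero_mul, lt_irrefl] at hψz
    · exact h2
  have hlog : ∀ y ∈ Ω, 0 < -u y - ε → Real.log (ψ y) =
      Real.log (Laplacian.laplacian u y) + β * Real.log (-u y - ε)
        + a / 2 * ‖∇ u y‖ ^ 2 + α / 2 * ‖y‖ ^ 2 := by
    intro y hy hyε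
    have h1 := Real.rpow_pos_of_pos hyε β
    have h2 := hpos y hy
    rw [hψ, Real.log_mul (mul_pos h1 h2).ne' (Real.exp_pos _).ne', Real.log_mul h1.ne' h2.ne',
      Real.log_rpow hyε, Real.log_exp]
    ring
  have hmax : IsLocalMax (fun y => Real.log (Laplacian.laplacian u y) + β * Real.log (-u y - ε)
        + a / 2 * ‖∇ u y‖ ^ 2 + α / 2 * ‖y‖ ^ 2) z := by
    have h1 : ContinuousAt (fun y => -u y - ε) z :=
      (((hu.continuousOn.continuousAt (hΩ.mem_nhds hzΩ))).neg).sub continuousAt_const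
    filter_upwards [hΩ.mem_nhds hzΩ, h1.eventually (lt_mem_nhds hzε)] with y hy hyε
    rw [← hlog y hy hyε, ← hlog z hzΩ hzε]
    have hyS : y ∈ S := ⟨subset_closure hy, by
      simp only [Set.mem_preimage, Set.mem_Iic]; linarith⟩
    have hψy : 0 < ψ y :=
      mul_pos (mul_pos (Real.rpow_pos_of_pos hyε _) (hpos y hy)) (Real.exp_pos _)
    exact Real.log_le_log hψy (hzmax hyS)
  have hwA : -u z - ε ≤ A := by linarith [hA z hzΩ]
  have hAβ : A ^ (β - 1) ≤ A ^ β := Real.rpow_le_rpow_of_exponent_le hA1 (by linarith)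
  -- If s < K, bound w^β by A^β; otherwise s w < K, and one factor w is split off from w^β. The
  -- assumption A ≥ 1 lets A^β serve in both cases.
  have hmain : (-u z - ε) ^ β * Laplacian.laplacian u z ≤ A ^ β * K := by
    by_cases hsK : K ≤ Laplacian.laplacian u z
    · have h1 := hcrit z hzΩ hzε hmax hsK
      have h2 : (-u z - ε) ^ β = (-u z - ε) ^ (β - 1) * (-u z - ε) := by
        rw [← Real.rpow_add_one hzε.ne', sub_add_cancel]
      rw [h2, mul_assoc, mul_comm (-u z - ε) (Laplacian.laplacian u z)]
      have h3 : (-u z - ε) ^ (β - 1) ≤ A ^ β :=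
        (Real.rpow_le_rpow hzε.le hwA (by linarith)).trans hAβ
      exact mul_le_mul h3 (not_le.1 h1).le (mul_pos (hpos z hzΩ) hzε).le
        (Real.rpow_nonneg (by linarith) _)
    · exact mul_le_mul (Real.rpow_le_rpow hzε.le hwA hβ0.le) (not_le.1 hsK).le (hpos z hzΩ).le
        (Real.rpow_nonneg (by linarith) _)
  have hexp : Real.exp (a / 2 * ‖∇ u z‖ ^ 2 + α / 2 * ‖z‖ ^ 2) ≤
      Real.exp (a / 2 * B ^ 2 + α / 2 * R ^ 2) := by
    have := hB z hzΩ
    have := hR z hzΩ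
    gcongr
  calc (-u x - ε) ^ β * Laplacian.laplacian u x ≤ ψ x := by
        refine le_mul_of_one_le_right
          (mul_pos (Real.rpow_pos_of_pos hxε _) (hpos x hx)).le (Real.one_le_exp (by positivity))
    _ ≤ ψ z := hzmax hxS
    _ ≤ _ := mul_le_mul hmain hexp (Real.exp_pos _).le
        (mul_nonneg (Real.rpow_nonneg (by linarith) _) hK)

end HessianEq

/-! ### The interior estimate -/

theorem theorem1 {n : ℕ} (Ω : Set (EuclideanSpace ℝ (Fin n)))
    (hΩ_open : IsOpen Ω) (hΩ_conn : IsConnected Ω) (hΩ_bdd : Bornology.IsBounded Ω)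
    (f : EuclideanSpace ℝ (Fin n) × ℝ × EuclideanSpace ℝ (Fin n) → ℝ)
    (hf_smooth : ContDiffOn ℝ 2 f (closure Ω ×ˢ Set.univ))
    (hf_pos : ∀ y ∈ closure Ω ×ˢ (Set.univ : Set (ℝ × EuclideanSpace ℝ (Fin n))), 0 < f y)
    (A B : ℝ) :
    ∃ β : ℝ, 0 < β ∧ ∃ C : ℝ, 0 < C ∧
      ∀ u : EuclideanSpace ℝ (Fin n) → ℝ, HessianEq.IsSolution 2 Ω f u →
        (∀ x ∈ Ω, |u x| ≤ A) → (∀ x ∈ Ω, ‖∇ u x‖ ≤ B) →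
          ∀ x ∈ Ω, (-u x) ^ β * Laplacian.laplacian u x ≤ C := by
  obtain ⟨R, hR0, hR⟩ : ∃ R, 0 < R ∧ ∀ x ∈ Ω, ‖x‖ ≤ R := hΩ_bdd.exists_pos_norm_le
  set Q : Set (EuclideanSpace ℝ (Fin n) × ℝ × EuclideanSpace ℝ (Fin n)) :=
    closure Ω ×ˢ (Set.Icc (-A) A ×ˢ Metric.closedBall 0 B) with hQ
  have hQc : IsCompact Q :=
    hΩ_bdd.isCompact_closure.prod (isCompact_Icc.prod (isCompact_closedBall _ _))
  have hQS : Q ⊆ closure Ω ×ˢ Set.univ := Set.prod_mono_right (Set.subset_univ _)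
  have hO : IsOpen (Ω ×ˢ (Set.univ : Set (ℝ × EuclideanSpace ℝ (Fin n)))) :=
    hΩ_open.prod isOpen_univ
  have hOS : Ω ×ˢ (Set.univ : Set (ℝ × EuclideanSpace ℝ (Fin n))) ⊆ closure Ω ×ˢ Set.univ :=
    Set.prod_mono_left subset_closure
  obtain ⟨M₀, hM₀, hbound⟩ := hf_smooth.exists_bound_derivatives hO hOS hQc hQS
  obtain ⟨c₀, hc₀, hfc⟩ := hQc.exists_forall_le' (hf_smooth.continuousOn.mono hQS)
    (a := 0) fun y hy => hf_pos y (hQS hy)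
  -- `A` and `B` are arbitrary reals; the maxima with 1 and 0 supply the signs needed to choose the
  -- constants.
  have hB' : 0 ≤ max B 0 := le_max_right _ _
  set M := M₀ * (n * (1 + max B 0) ^ 2 + max B 0 + 4) with hM
  have hM0 : 0 ≤ M := by positivity
  obtain ⟨a, α, β, K, ha, hα, hβ, h1, h2, h3, h4, h5, h6, h7, h8⟩ :=
    exists_constants n hM0 hB' hR0.le (show 0 < 2 * c₀ by positivity)
  have hA1 : 1 ≤ max A 1 := le_max_right _ _
  refine ⟨β, by linarith,
    (max A 1) ^ β * K * Real.exp (a / 2 * (max B 0) ^ 2 + α / 2 * R ^ 2), by positivity, ?_⟩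
  intro u hu hA hB x hx
  have hpos : ∀ x ∈ Ω, 0 < Laplacian.laplacian u x := fun x hx => hu.laplacian_pos hΩ_open hx
  have hneg := neg_of_laplacian_pos hΩ_open hΩ_bdd hu.kConvex.1 hu.continuousOn hpos hu.boundary
  have hB₀ : ∀ x ∈ Ω, ‖∇ u x‖ ≤ max B 0 := fun x hx => (hB x hx).trans (le_max_left _ _)
  -- All constants are independent of ε and of u, so the bound survives the limit ε → 0⁺.
  have key : ∀ᶠ ε in 𝓝[>] (0 : ℝ), (-u x - ε) ^ β * Laplacian.laplacian u x ≤
      (max A 1) ^ β * K * Real.exp (a / 2 * (max B 0) ^ 2 + α / 2 * R ^ 2) := by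
    filter_upwards [Ioo_mem_nhdsGT (show 0 < -u x by linarith [hneg x hx])] with ε hε
    refine HessianEq.rpow_mul_laplacian_le hΩ_open hΩ_bdd hu.contDiffOn hu.continuousOn hpos
      hu.boundary ha.le hα.le (by linarith) hε.1 (by linarith)
      (fun y hy => ((neg_le_abs _).trans (hA y hy)).trans (le_max_left _ _)) hA1 hB₀ hR ?_ hx
      (by linarith [hε.2])
    intro y hy hyε hmax hK hK'
    have hyQ : (y, u y, ∇ u y) ∈ Q :=
      ⟨subset_closure hy, abs_le.1 (hA y hy), by simpa using hB y hy⟩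
    have hyO : (y, u y, ∇ u y) ∈ Ω ×ˢ (Set.univ : Set (ℝ × EuclideanSpace ℝ (Fin n))) :=
      ⟨hy, Set.mem_univ _⟩
    obtain ⟨hf0, hf1, hf2⟩ := hbound _ hyQ hyO
    exact hu.false_of_isLocalMax hΩ_open hy hB' hR0.le hc₀ hM₀
      ((hf_smooth.mono hOS).contDiffAt (hO.mem_nhds hyO)) hf0 hf1 hf2 (hfc _ hyQ) (hB₀ y hy)
      (hR y hy) hM ha hβ h1 h2 h3 h4 h5 h6 h7 h8 hyε hmax hK hK'
  have hlim : Tendsto (fun ε : ℝ => (-u x - ε) ^ β * Laplacian.laplacian u x) (𝓝[>] 0)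
      (𝓝 ((-u x) ^ β * Laplacian.laplacian u x)) := by
    have h9 : ContinuousAt (fun ε : ℝ => (-u x - ε) ^ β * Laplacian.laplacian u x) 0 :=
      ((continuousAt_const.sub continuousAt_id).rpow_const
        (Or.inr (by linarith))).mul continuousAt_const
    have := h9.tendsto.mono_left (nhdsWithin_le_nhds (s := Set.Ioi 0))
    simpa using this
  exact le_of_tendsto hlim key
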